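/- **Setting.** Let $\mathcal Q=\mathbb R^n$, $\mathcal N=\mathbb R^m$, let $f:\mathbb R^n\times\mathbb R^n\to\mathbb R^n$, $\rho:\mathbb R^n\to\mathbb R^{n\times m}$ with $\rho(q)$ injective, $\mathrm g:\mathbb R^n\to\mathbb R^{m\times m}$ with $\mathrm g(q)$ symmetric positive definite, and $\phi:\mathbb R^n\times\mathbb R^n\to\mathbb R$ be sufficiently often continuously differentiable (a fixed finite number of times, independent of all data). Put $b(q)=\rho(q)\mathrm g(q)^{-1}\rho(q)^\top$, $y=(q,\lambda)\in T^*\mathcal Q=\mathbb R^n\times\mathbb R^n$, and $$\tilde{\mathcal L}(q,\lambda,v,v_\lambda)=v_\lambda^\top v+\lambda^\top f(q,v)+\tfrac12\lambda^\top b(q)\lambda .$$ The exact discrete Lagrangian is $\tilde{\mathcal L}_d^e(y_0,y_1,h)=\int_0^h\tilde{\mathcal L}(y,\dot y)\,dt$, where $y$ solves the Euler–Lagrange equations of $\tilde{\mathcal L}$ on $[0,h]$ with $y(0)=y_0$, $y(h)=y_1$ and $(y,\dot y)$ stays in a prescribed bounded open set $W\subset T(T^*\mathcal Q)$. For $\alpha,\gamma\in[0,1]$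 let $$\tilde{\mathcal L}_d(y_0,y_1,h)=h\alpha\,\tilde{\mathcal L}\big(\gamma y_0+(1-\gamma)y_1,\tfrac{y_1-y_0}{h}\big)+h(1-\alpha)\,\tilde{\mathcal L}\big((1-\gamma)y_0+\gamma y_1,\tfrac{y_1-y_0}{h}\big).$$ For a discrete Lagrangian $L_d\in\{\tilde{\mathcal L}_d,\tilde{\mathcal L}_d^e\}$ put $v_0^-=-D_{\lambda_0}L_d(y_0,y_1,h)$ and $v_N^+=D_{\lambda_N}L_d(y_{N-1},y_N,h)$. Its discrete optimality conditions for $y_0,\dots,y_N$ and multipliers $\mu,\nu$ (with the transversality conditions $\lambda_0=\nu$, $\lambda_N=-D_2\phi$ replacing the variations of $\lambda_0,\lambda_N$, and inserted in the remaining conditions) are $$\tfrac1h\big(D_2L_d(y_{k-1},y_k,h)+D_1L_d(y_k,y_{k+1},h)\big)=0\quad(1\le k\le N-1),$$ $$\mu-D_{q_0}L_d(y_0,y_1,h)=0,\qquad D_1\phi(q_N,v_N^+)-D_{q_N}L_d(y_{N-1},y_N,h)=0,$$ $$q_0=q^0,\qquad v_0^-=\dot q^0,\qquad \lambda_0=\nu,\qquad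 \lambda_N+D_2\phi(q_N,v_N^+)=0 .$$ *Order.* Let $W$ be any bounded open set and $K\subset W$ any compact set. All bounds below are with constants $C$, $h_0>0$ that depend only on $W$, $K$, $\alpha$, $\gamma$ and the data $f,\rho,\mathrm g,\phi$. $\tilde{\mathcal L}_d$ *is of order $r$* if $|\tilde{\mathcal L}_d-\tilde{\mathcal L}_d^e|(y(0),y(h),h)\le Ch^{r+1}$ for all $0<h\le h_0$ and all Euler–Lagrange solutions $y$ on $[0,h]$ with $(y,\dot y)\in K$. $\tilde{\mathcal L}_d$ *approximates the exact discrete optimality conditions to order $r$* if, for all $T>0$ and $N\ge1$ with $h=T/N\le h_0$, all Euler–Lagrange solutions $y$ on $[0,T]$ with $(y,\dot y)\in K$, and all $\mu,\nu,q^0,\dot q^0$, the left-hand sides (minus the right-hand sides) of each of the above conditions for $\tilde{\mathcal L}_d$ and for $\tilde{\mathcal L}_d^e$ at $y_k=y(kh)$ differ by at most $Ch^r$. **Proposition.** For small $h$ the exact discrete Lagrangian is well defined: for all $W,K$ there is $h_0>0$ such that for every $0<h\le h_0$ and every Euler–Lagrange solution $y$ on $[0,h]$ with $(y,\dot y)\in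 K$, all pairs of endpoints close to $(y(0),y(h))$ are joined in time $h$ by exactly one solution with $(y,\dot y)\in W$, and $\tilde{\mathcal L}_d^e(\cdot,\cdot,h)$ is differentiable at $(y(0),y(h))$. Moreover: 1. If $\alpha=\tfrac12$ (any $\gamma\in[0,1]$) or $\gamma=\tfrac12$ (any $\alpha\in[0,1]$), then $\tilde{\mathcal L}_d$ is of order $2$ and approximates the exact discrete optimality conditions to order $2$. 2. For all other $\alpha,\gamma\in[0,1]$, $\tilde{\mathcal L}_d$ is of order $1$ and approximates the exact discrete optimality conditions to order $1$; if $m\ge1$, then neither holds with order $2$. -/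

import Mathlib

open Set Filter Topology

noncomputable section

/-- Configurations, velocities and costates for `𝒬 = ℝⁿ`; the pairing `λᵀ v` is `inner ℝ λ v`. -/
abbrev Conf (n : ℕ) : Type := EuclideanSpace ℝ (Fin n)

/-- The state-costate space `T*𝒬 = ℝⁿ × ℝⁿ`, with points `y = (q, λ)`. -/
abbrev Phase (n : ℕ) : Type := Conf n × Conf n

/-- `b(q) = ρ(q) g(q)⁻¹ ρ(q)ᵀ`. -/
def controlMatrix {n m : ℕ} (ρ : Conf n → (Conf m →L[ℝ] Conf n))
    (g : Conf n → (Conf m →L[ℝ] Conf m)) (q : Conf n) : Conf n →L[ℝ] Conf n :=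
  (ρ q).comp ((ContinuousLinearMap.inverse (g q)).comp (ContinuousLinearMap.adjoint (ρ q)))

/-- The control-independent new Lagrangian
`L(q, λ, v, v_λ) = v_λᵀ v + λᵀ f(q, v) + ½ λᵀ b(q) λ`, as a function of `((q, λ), (v, v_λ))`. -/
def newLagrangian {n m : ℕ} (f : Conf n × Conf n → Conf n) (ρ : Conf n → (Conf m →L[ℝ] Conf n))
    (g : Conf n → (Conf m →L[ℝ] Conf m)) (x : Phase n × Phase n) : ℝ :=
  inner ℝ x.2.2 x.2.1 + inner ℝ x.1.2 (f (x.1.1, x.2.1))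
    + (1 / 2) * inner ℝ x.1.2 (controlMatrix ρ g x.1.1 x.1.2)

section Continuous

variable {n : ℕ}

/-- `y : [a, b] → T*𝒬`, with velocity `v = ẏ`, solves the Euler-Lagrange equations
`d/dt (∂L/∂ẏ) = ∂L/∂y` on `[a, b]`. -/
def IsEulerLagrangeArc (L : Phase n × Phase n → ℝ) (a b : ℝ) (y v : ℝ → Phase n) : Prop :=
  ∀ t ∈ Icc a b,
    HasDerivWithinAt y (v t) (Icc a b) t ∧
    HasDerivWithinAt (fun s => fderiv ℝ (fun w => L (y s, w)) (v s))
      (fderiv ℝ (fun z => L (z, v t)) (y t)) (Icc a b) t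

/-- `(y, v)` is an Euler-Lagrange arc on `[0, h]` from `y₀` to `y₁` whose positions and velocities
stay in `W`. -/
def IsConnectingArc (L : Phase n × Phase n → ℝ) (W : Set (Phase n × Phase n))
    (y₀ y₁ : Phase n) (h : ℝ) (y v : ℝ → Phase n) : Prop :=
  IsEulerLagrangeArc L 0 h y v ∧ y 0 = y₀ ∧ y h = y₁ ∧ ∀ t ∈ Icc 0 h, (y t, v t) ∈ W

open Classical in
/-- The exact discrete Lagrangian `L_d^e(y₀, y₁, h) = ∫₀ʰ L(y, ẏ) dt`, where `y` is the solution of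
the Euler-Lagrange equations with `y(0) = y₀`, `y(h) = y₁`. As two-point boundary value problems
are uniquely solvable only locally, `y` is the solution with position and velocity in a given
bounded open set `W`; the value is `0` when there is none. -/
def exactDiscreteLagrangian (L : Phase n × Phase n → ℝ) (W : Set (Phase n × Phase n))
    (y₀ y₁ : Phase n) (h : ℝ) : ℝ :=
  if hx : ∃ c : (ℝ → Phase n) × (ℝ → Phase n), IsConnectingArc L W y₀ y₁ h c.1 c.2 then
    ∫ t in (0 : ℝ)..h, L (hx.choose.1 t, hx.choose.2 t)
  else 0

/-- For short time steps the exact discrete Lagrangian is well defined and differentiable around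
pairs of endpoints of Euler-Lagrange arcs: nearby endpoints are joined by exactly one
Euler-Lagrange arc in `W`. -/
def ExactDiscreteLagrangianWellDefined (L : Phase n × Phase n → ℝ) : Prop :=
  ∀ W K : Set (Phase n × Phase n), IsOpen W → Bornology.IsBounded W → IsCompact K → K ⊆ W →
    ∃ h₀ > 0, ∀ h : ℝ, 0 < h → h ≤ h₀ → ∀ y v : ℝ → Phase n,
      IsEulerLagrangeArc L 0 h y v → (∀ t ∈ Icc 0 h, (y t, v t) ∈ K) →
        (∀ᶠ z in 𝓝 (y 0, y h), ∃ y₁ v₁ : ℝ → Phase n,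
          IsConnectingArc L W z.1 z.2 h y₁ v₁ ∧
          ∀ y₂ v₂ : ℝ → Phase n, IsConnectingArc L W z.1 z.2 h y₂ v₂ →
            EqOn y₂ y₁ (Icc 0 h) ∧ EqOn v₂ v₁ (Icc 0 h)) ∧
        DifferentiableAt ℝ
          (fun z : Phase n × Phase n => exactDiscreteLagrangian L W z.1 z.2 h) (y 0, y h)

end Continuous

section Discrete

variable {n : ℕ}

/-- The low-order discrete Lagrangian `h α L(ȳ^γ, Δy) + h (1 - α) L(ȳ^(1-γ), Δy)` with
`ȳ^γ = γ y₀ + (1 - γ) y₁` and `Δy = (y₁ - y₀) / h`. -/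
def lowOrderDiscreteLagrangian (L : Phase n × Phase n → ℝ) (α γ : ℝ)
    (y₀ y₁ : Phase n) (h : ℝ) : ℝ :=
  h * α * L (γ • y₀ + (1 - γ) • y₁, h⁻¹ • (y₁ - y₀))
    + h * (1 - α) * L ((1 - γ) • y₀ + γ • y₁, h⁻¹ • (y₁ - y₀))

/-- `D₁ L_d(y₀, y₁, h)`. -/
def slotD1 (Ld : Phase n → Phase n → ℝ → ℝ) (y₀ y₁ : Phase n) (h : ℝ) : Phase n →L[ℝ] ℝ :=
  fderiv ℝ (fun y => Ld y y₁ h) y₀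

/-- `D₂ L_d(y₀, y₁, h)`. -/
def slotD2 (Ld : Phase n → Phase n → ℝ → ℝ) (y₀ y₁ : Phase n) (h : ℝ) : Phase n →L[ℝ] ℝ :=
  fderiv ℝ (fun y => Ld y₀ y h) y₁

/-- The discrete velocity `v₀⁻ = - D_{λ₀} L_d(y₀, y₁, h)`. -/
def velocityMinus (Ld : Phase n → Phase n → ℝ → ℝ) (y₀ y₁ : Phase n) (h : ℝ) : Conf n :=
  - gradient (fun l => Ld (y₀.1, l) y₁ h) y₀.2

/-- The discrete velocity `v₁⁺ = D_{λ₁} L_d(y₀, y₁, h)`. -/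
def velocityPlus (Ld : Phase n → Phase n → ℝ → ℝ) (y₀ y₁ : Phase n) (h : ℝ) : Conf n :=
  gradient (fun l => Ld y₀ (y₁.1, l) h) y₁.2

/- The discrete necessary optimality conditions of a discrete Lagrangian `L_d`, each written as
`residual = 0`, for a discrete curve `y₀, …, y_N`, multipliers `μ, ν`, initial data `q⁰, v⁰` and
terminal cost `φ(q, v)`. The variations of `λ₀`, `λ_N` are replaced by the transversality
conditions `λ₀ = ν`, `λ_N = - D₂φ`, which have been inserted in the other conditions. -/

/-- Discrete Euler-Lagrange equation at `y_k`, normalised by `1 / h` so that it is a difference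
quotient approximation of the Euler-Lagrange equations. -/
def residualEL (Ld : Phase n → Phase n → ℝ → ℝ) (yd : ℕ → Phase n) (h : ℝ) (k : ℕ) :
    Phase n →L[ℝ] ℝ :=
  h⁻¹ • (slotD2 Ld (yd (k - 1)) (yd k) h + slotD1 Ld (yd k) (yd (k + 1)) h)

/-- Variation of `q₀`: `μ - D_{q₀} L_d(y₀, y₁, h) = 0`. -/
def residualQ0 (Ld : Phase n → Phase n → ℝ → ℝ) (yd : ℕ → Phase n) (h : ℝ) (μ : Conf n) :
    Conf n :=
  μ - gradient (fun q => Ld (q, (yd 0).2) (yd 1) h) (yd 0).1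

/-- Variation of `q_N`: `D₁φ(q_N, v_N⁺) - D_{q_N} L_d(y_{N-1}, y_N, h) = 0`. -/
def residualQN (Ld : Phase n → Phase n → ℝ → ℝ) (φ : Conf n × Conf n → ℝ) (yd : ℕ → Phase n)
    (h : ℝ) (N : ℕ) : Conf n :=
  gradient (fun q => φ (q, velocityPlus Ld (yd (N - 1)) (yd N) h)) (yd N).1
    - gradient (fun q => Ld (yd (N - 1)) (q, (yd N).2) h) (yd N).1

/-- Variation of `μ`: `q₀ - q⁰ = 0`; it does not involve the discrete Lagrangian. -/
def residualMu (_Ld : Phase n → Phase n → ℝ → ℝ) (yd : ℕ → Phase n) (qInit : Conf n) : Conf n :=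
  (yd 0).1 - qInit

/-- Variation of `ν`: `v₀⁻ - v⁰ = 0`. -/
def residualNu (Ld : Phase n → Phase n → ℝ → ℝ) (yd : ℕ → Phase n) (h : ℝ) (vInit : Conf n) :
    Conf n :=
  velocityMinus Ld (yd 0) (yd 1) h - vInit

/-- Transversality at the initial time: `λ₀ - ν = 0`; it does not involve the discrete
Lagrangian. -/
def residualV0 (_Ld : Phase n → Phase n → ℝ → ℝ) (yd : ℕ → Phase n) (ν : Conf n) : Conf n :=
  (yd 0).2 - ν

/-- Transversality at the final time: `λ_N + D₂φ(q_N, v_N⁺) = 0`. -/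
def residualVN (Ld : Phase n → Phase n → ℝ → ℝ) (φ : Conf n × Conf n → ℝ) (yd : ℕ → Phase n)
    (h : ℝ) (N : ℕ) : Conf n :=
  (yd N).2
    + gradient (fun v => φ ((yd N).1, v)) (velocityPlus Ld (yd (N - 1)) (yd N) h)

/-- All discrete optimality conditions of `Ld` and `Ld'` differ by at most `ε` at the discrete
curve `yd` with `N` steps of size `h` and the multipliers `μ, ν`. -/
structure ConditionsWithin (Ld Ld' : Phase n → Phase n → ℝ → ℝ) (φ : Conf n × Conf n → ℝ)
    (qInit vInit : Conf n) (yd : ℕ → Phase n) (μ ν : Conf n) (h : ℝ) (N : ℕ) (ε : ℝ) : Prop where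
  eulerLagrange : ∀ k, 1 ≤ k → k + 1 ≤ N → ‖residualEL Ld yd h k - residualEL Ld' yd h k‖ ≤ ε
  varQ0 : ‖residualQ0 Ld yd h μ - residualQ0 Ld' yd h μ‖ ≤ ε
  varQN : ‖residualQN Ld φ yd h N - residualQN Ld' φ yd h N‖ ≤ ε
  varMu : ‖residualMu Ld yd qInit - residualMu Ld' yd qInit‖ ≤ ε
  varNu : ‖residualNu Ld yd h vInit - residualNu Ld' yd h vInit‖ ≤ ε
  varV0 : ‖residualV0 Ld yd ν - residualV0 Ld' yd ν‖ ≤ ε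
  varVN : ‖residualVN Ld φ yd h N - residualVN Ld' φ yd h N‖ ≤ ε

end Discrete

section Order

variable {n : ℕ}

/-- The discrete Lagrangian `Ld` is of order `r`: along Euler-Lagrange arcs it agrees with the
exact discrete Lagrangian up to `O(h^(r+1))`, locally uniformly. -/
def LagrangianHasOrder (L : Phase n × Phase n → ℝ) (Ld : Phase n → Phase n → ℝ → ℝ) (r : ℕ) :
    Prop :=
  ∀ W K : Set (Phase n × Phase n), IsOpen W → Bornology.IsBounded W → IsCompact K → K ⊆ W →
    ∃ C : ℝ, ∃ h₀ > 0, ∀ h : ℝ, 0 < h → h ≤ h₀ → ∀ y v : ℝ → Phase n,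
      IsEulerLagrangeArc L 0 h y v → (∀ t ∈ Icc 0 h, (y t, v t) ∈ K) →
        |Ld (y 0) (y h) h - exactDiscreteLagrangian L W (y 0) (y h) h| ≤ C * h ^ (r + 1)

/-- The discrete optimality conditions of `Ld` approximate the exact ones to order `r`: at the
grid values `y(0), y(h), …, y(N h)`, `h = T / N`, of a solution `y` of the Euler-Lagrange equations
on `[0, T]`, the two sets of conditions differ by `O(h^r)`, locally uniformly. -/
def ConditionsHaveOrder (L : Phase n × Phase n → ℝ) (φ : Conf n × Conf n → ℝ)
    (Ld : Phase n → Phase n → ℝ → ℝ) (r : ℕ) : Prop :=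
  ∀ W K : Set (Phase n × Phase n), IsOpen W → Bornology.IsBounded W → IsCompact K → K ⊆ W →
    ∃ C : ℝ, ∃ h₀ > 0, ∀ (T : ℝ) (N : ℕ), 0 < T → 1 ≤ N → T / N ≤ h₀ → ∀ y v : ℝ → Phase n,
      IsEulerLagrangeArc L 0 T y v → (∀ t ∈ Icc 0 T, (y t, v t) ∈ K) →
        ∀ qInit vInit μ ν : Conf n,
          ConditionsWithin Ld (exactDiscreteLagrangian L W) φ qInit vInit
            (fun k => y (k * (T / N))) μ ν (T / N) N (C * (T / N) ^ r)

end Order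

end

/-! The momentum of `newLagrangian` is `p = (v_λ + (∂f/∂v)ᵀ λ, v)`, a triangular expression, so the
Legendre transform is inverted by a formula and the Euler-Lagrange equations become a second order
equation `y'' = F(y, y')` with `F` of class `C²`.

Exact side: on the bounded set `W` the field `F` agrees with a globally Lipschitz one. For small `h`
the boundary value problem is then solved by a contraction, and solutions depend on their endpoints
with Lipschitz constant `4 / h`. The first variation of the action along a solution consists of
boundary terms, so the exact discrete Lagrangian has the endpoint derivatives `-p(0)` and `p(h)`
(`exists_exactDiscreteLagrangian`). Its discrete Euler-Lagrange residual therefore vanishes along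
solutions.

Low-order side: one function `M_α(y, Δ, s)`, `discreteMomentum`, gives both endpoint derivatives:
`M_α` at `y₀` with step `h`, and `-M_{1-α}` at `y₁` with step `-h`. Put `κ = (1 - 2α)(1 - 2γ) / 2`,
which vanishes exactly when `α = 1/2` or `γ = 1/2`. Along a solution `M_α = -p + s κ (∂L/∂y +
(∂p/∂y) v) + O(s²)`, and the error of the discrete Lagrangian is `-h² κ (∂L/∂y) v + O(h³)`. This
settles the boundary conditions and the Lagrangian. The discrete Euler-Lagrange residual is `M_α(h)
- M_{1-α}(-h)`, divided by `h`. Passing to `1 - α` flips the sign of `κ`, so the linear terms always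
cancel; if `κ = 0`, then `M_{1-α} = M_α`, and a difference of the form `H(h) - H(-h)` has no
quadratic term either.

Sharpness: if `κ ≠ 0`, both orders fail as soon as `(∂L/∂λ) η ≠ 0` at some state with `q = 0`, `v =
0`, `v_λ = η`. Otherwise `λ ↦ λᵀ f(0, 0) + ½ λᵀ b(0) λ` would be constant, although `b(0)` is
positive on the range of `ρ(0)`. -/

/-! ### Estimates on bounded sets -/

section Bounded

variable {X Y Z : Type*} [NormedAddCommGroup X] [NormedSpace ℝ X] [FiniteDimensional ℝ X]
  [NormedAddCommGroup Y] [NormedSpace ℝ Y] [NormedAddCommGroup Z] [NormedSpace ℝ Z]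
  [FiniteDimensional ℝ Z]

omit [NormedSpace ℝ Y] in
theorem Continuous.exists_norm_le_of_isBounded {g : X → Y} (hg : Continuous g) {S : Set X}
    (hS : Bornology.IsBounded S) : ∃ C : ℝ, 0 ≤ C ∧ ∀ x ∈ S, ‖g x‖ ≤ C := by
  have := FiniteDimensional.proper ℝ X
  obtain ⟨C, hC⟩ := hS.isCompact_closure.exists_bound_of_continuousOn hg.continuousOn
  exact ⟨max C 0, le_max_right _ _, fun x hx => (hC x (subset_closure hx)).trans (le_max_left _ _)⟩

/-- The mean value inequality is applied on a ball containing `S`, since `S` itself need not be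
convex. -/
theorem ContDiff.exists_lipschitz_of_isBounded {g : X → Y} {k : WithTop ℕ∞} (hg : ContDiff ℝ k g)
    (hk : k ≠ 0) {S : Set X} (hS : Bornology.IsBounded S) :
    ∃ C : ℝ, 0 ≤ C ∧ ∀ x ∈ S, ∀ y ∈ S, ‖g x - g y‖ ≤ C * ‖x - y‖ := by
  obtain ⟨R, hR⟩ := hS.subset_closedBall (0 : X)
  obtain ⟨C, hC0, hC⟩ := (hg.continuous_fderiv hk).exists_norm_le_of_isBounded
    (Metric.isBounded_closedBall (x := (0 : X)) (r := R))
  exact ⟨C, hC0, fun x hx y hy => (convex_closedBall (0 : X) R).norm_image_sub_le_of_norm_fderiv_le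
    (fun z _ => hg.differentiable hk z) hC (hR hy) (hR hx)⟩

/-- A function with bounded second derivative is close to its linearisation. -/
theorem ContDiff.exists_norm_sub_fderiv_le_of_isBounded {g : X → Y} (hg : ContDiff ℝ 2 g)
    {S : Set X} (hS : Bornology.IsBounded S) :
    ∃ C : ℝ, 0 ≤ C ∧ ∀ x ∈ S, ∀ y ∈ S, ‖g y - g x - fderiv ℝ g x (y - x)‖ ≤ C * ‖y - x‖ ^ 2 := by
  obtain ⟨R, hR⟩ := hS.subset_closedBall (0 : X)
  obtain ⟨C, hC0, hC⟩ := (hg.fderiv_right (m := 1) (by norm_num)).exists_lipschitz_of_isBounded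
    one_ne_zero (Metric.isBounded_closedBall (x := (0 : X)) (r := R))
  refine ⟨C, hC0, fun x hx y hy => ?_⟩
  have hseg : segment ℝ x y ⊆ Metric.closedBall 0 R :=
    (convex_closedBall (0 : X) R).segment_subset (hR hx) (hR hy)
  have := (convex_segment (𝕜 := ℝ) x y).norm_image_sub_le_of_norm_fderiv_le (𝕜 := ℝ)
    (f := fun z => g z - fderiv ℝ g x z) (C := C * ‖y - x‖)
    (fun z _ => ((hg.differentiable (by norm_num) z).sub (fderiv ℝ g x).differentiableAt))
    (fun z hz => ?_) (left_mem_segment ℝ x y) (right_mem_segment ℝ x y)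
  · calc _ = ‖g y - fderiv ℝ g x y - (g x - fderiv ℝ g x x)‖ := by rw [map_sub]; congr 1; abel
      _ ≤ _ := this
      _ = _ := by ring
  · rw [fderiv_fun_sub (hg.differentiable (by norm_num) z) (fderiv ℝ g x).differentiableAt,
      ContinuousLinearMap.fderiv]
    refine (hC z (hseg hz) x (hR hx)).trans ?_
    gcongr
    rw [segment_eq_image'] at hz
    obtain ⟨s, hs, rfl⟩ := hz
    simp only [add_sub_cancel_left, norm_smul, Real.norm_eq_abs, abs_of_nonneg hs.1]
    exact mul_le_of_le_one_left (norm_nonneg _) hs.2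

/-- A bound on the derivative by a power of the distance integrates. -/
theorem norm_le_mul_abs_pow_succ {g g' : ℝ → Y} {a b C t : ℝ} {k : ℕ} (hC : 0 ≤ C)
    (ht : t ∈ Icc a b) (hg : ∀ s ∈ Icc a b, HasDerivWithinAt g (g' s) (Icc a b) s)
    (hb : ∀ s ∈ Icc a b, ‖g' s‖ ≤ C * |s - t| ^ k) (h0 : g t = 0) :
    ∀ s ∈ Icc a b, ‖g s‖ ≤ C * |s - t| ^ (k + 1) := by
  intro s hs
  have hsub : uIcc t s ⊆ Icc a b := uIcc_subset_Icc ht hs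
  have := (convex_uIcc t s).norm_image_sub_le_of_norm_hasDerivWithin_le (f := g) (f' := g')
    (C := C * |s - t| ^ k) (fun r hr => (hg r (hsub hr)).mono hsub)
    (fun r hr => (hb r (hsub hr)).trans ?_) left_mem_uIcc right_mem_uIcc
  · rw [h0, sub_zero, Real.norm_eq_abs] at this
    rwa [pow_succ, ← mul_assoc]
  · have : |r - t| ≤ |s - t| := abs_sub_left_of_mem_uIcc hr
    gcongr

/-- The derivative of a function on `Z × ℝ` in the last variable. -/
noncomputable def timeDeriv (H : Z × ℝ → Y) (p : Z × ℝ) : Y := fderiv ℝ H p (0, 1)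

omit [FiniteDimensional ℝ Z] in
theorem contDiff_timeDeriv {H : Z × ℝ → Y} {k l : WithTop ℕ∞} (hH : ContDiff ℝ k H)
    (hl : l + 1 ≤ k) : ContDiff ℝ l (timeDeriv H) :=
  (hH.fderiv_right hl).clm_apply contDiff_const

omit [FiniteDimensional ℝ Z] in
theorem hasDerivAt_timeDeriv {H : Z × ℝ → Y} (hH : Differentiable ℝ H) (z : Z) (s : ℝ) :
    HasDerivAt (fun s => H (z, s)) (timeDeriv H (z, s)) s :=
  (hH (z, s)).hasFDerivAt.comp_hasDerivAt s ((hasDerivAt_const s z).prodMk (hasDerivAt_id s))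

/-- The constant is uniform in the parameter `z`. The jet of a solution will play the role of `z`,
so that one constant serves all arcs. -/
theorem exists_taylor_zero {H : Z × ℝ → Y} (hH : ContDiff ℝ 1 H) {S : Set Z}
    (hS : Bornology.IsBounded S) :
    ∃ C : ℝ, 0 ≤ C ∧ ∀ z ∈ S, ∀ s ∈ Icc (-1 : ℝ) 1, ‖H (z, s) - H (z, 0)‖ ≤ C * |s| := by
  obtain ⟨C, hC0, hC⟩ := hH.exists_lipschitz_of_isBounded one_ne_zero
    (hS.prod (Metric.isBounded_Icc (-1 : ℝ) 1))
  refine ⟨C, hC0, fun z hz s hs => (hC (z, s) ⟨hz, hs⟩ (z, 0) ⟨hz, by simp⟩).trans_eq ?_⟩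
  simp

theorem exists_taylor_one {H : Z × ℝ → Y} (hH : ContDiff ℝ 2 H) {S : Set Z}
    (hS : Bornology.IsBounded S) :
    ∃ C : ℝ, 0 ≤ C ∧ ∀ z ∈ S, ∀ s ∈ Icc (-1 : ℝ) 1,
      ‖H (z, s) - H (z, 0) - s • timeDeriv H (z, 0)‖ ≤ C * |s| ^ 2 := by
  obtain ⟨C, hC0, hC⟩ := exists_taylor_zero (contDiff_timeDeriv hH (l := 1) (by norm_num)) hS
  refine ⟨C, hC0, fun z hz s hs => ?_⟩
  have := norm_le_mul_abs_pow_succ (k := 1) (t := 0) (a := -1) (b := 1) hC0 (by simp)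
    (g := fun s => H (z, s) - H (z, 0) - s • timeDeriv H (z, 0))
    (g' := fun s => timeDeriv H (z, s) - timeDeriv H (z, 0))
    (fun s _ => by
      simpa using (((hasDerivAt_timeDeriv (hH.differentiable (by norm_num)) z s).sub_const
        (H (z, 0))).fun_sub ((hasDerivAt_id s).smul_const (timeDeriv H (z, 0)))).hasDerivWithinAt)
    (fun s hs => by simpa using hC z hz s hs) (by simp) s hs
  simpa using this

/-- The even part of the Taylor expansion cancels in `H(s) - H(-s)`. -/
theorem exists_taylor_odd {H : Z × ℝ → Y} (hH : ContDiff ℝ 3 H) {S : Set Z}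
    (hS : Bornology.IsBounded S) :
    ∃ C : ℝ, 0 ≤ C ∧ ∀ z ∈ S, ∀ s ∈ Icc (-1 : ℝ) 1,
      ‖H (z, s) - H (z, -s) - (2 * s) • timeDeriv H (z, 0)‖ ≤ C * |s| ^ 3 := by
  obtain ⟨C, hC0, hC⟩ := exists_taylor_one (contDiff_timeDeriv hH (l := 2) (by norm_num)) hS
  refine ⟨C + C, by positivity, fun z hz s hs => ?_⟩
  have hd := hasDerivAt_timeDeriv (hH.differentiable (by norm_num)) z
  have := norm_le_mul_abs_pow_succ (k := 2) (t := 0) (a := -1) (b := 1)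
    (add_nonneg hC0 hC0) (by simp)
    (g := fun s => H (z, s) - H (z, -s) - (2 * s) • timeDeriv H (z, 0))
    (g' := fun s => timeDeriv H (z, s) + timeDeriv H (z, -s) - (2 : ℝ) • timeDeriv H (z, 0))
    (fun s _ => by
      have h2 : HasDerivAt (fun s => H (z, -s)) _ s := (hd (-s)).scomp s (hasDerivAt_neg s)
      have h3 := (((hasDerivAt_id s).const_mul (2 : ℝ)).smul_const (timeDeriv H (z, 0)))
      have h4 := (((hd s).fun_sub h2).fun_sub h3).hasDerivWithinAt (s := Icc (-1) 1)
      simpa using h4)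
    (fun s hs => ?_) (by simp) s hs
  · simpa using this
  · have h1 := hC z hz s hs
    have h2 := hC z hz (-s) ⟨by linarith [hs.2], by linarith [hs.1]⟩
    rw [abs_neg] at h2
    rw [sub_zero, add_mul]
    refine le_trans (le_of_eq ?_) ((norm_add_le _ _).trans (add_le_add h1 h2))
    congr 1
    rw [two_smul, neg_smul]
    abel

/-- A continuously differentiable map agrees on a bounded set with a globally Lipschitz one. -/
theorem ContDiff.exists_lipschitzWith_eqOn {F : X → Y} (hF : ContDiff ℝ 1 F) {S : Set X}
    (hS : Bornology.IsBounded S) :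
    ∃ (G : X → Y) (Λ : NNReal), LipschitzWith Λ G ∧ ∀ x ∈ S, G x = F x := by
  obtain ⟨R, hR0, hR⟩ := hS.subset_closedBall_lt 0 (0 : X)
  let χ : ContDiffBump (0 : X) := ⟨R, R + 1, hR0, by linarith⟩
  have hc : ContDiff ℝ 1 (fun x => χ x • F x) := χ.contDiff.smul hF
  obtain ⟨Λ, hΛ⟩ := hc.lipschitzWith_of_hasCompactSupport
    (χ.hasCompactSupport.smul_right) one_ne_zero
  exact ⟨_, Λ, hΛ, fun x hx => by
    simp [χ.one_of_mem_closedBall (show x ∈ Metric.closedBall 0 χ.rIn from hR hx)]⟩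

end Bounded

/-! ### Second order equations and their two-point boundary value problem -/

section SecondOrder

variable {E : Type*} [NormedAddCommGroup E] [NormedSpace ℝ E]

/-- `y' = v` and `v' = F(y, v)` on `[a, b]`. -/
def IsSecondOrderArc (F : E × E → E) (a b : ℝ) (y v : ℝ → E) : Prop :=
  ∀ t ∈ Icc a b, HasDerivWithinAt y (v t) (Icc a b) t ∧
    HasDerivWithinAt v (F (y t, v t)) (Icc a b) t

theorem IsSecondOrderArc.congr {F G : E × E → E} {a b : ℝ} {y v : ℝ → E}
    (h : IsSecondOrderArc F a b y v) (hFG : ∀ t ∈ Icc a b, G (y t, v t) = F (y t, v t)) :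
    IsSecondOrderArc G a b y v :=
  fun t ht => ⟨(h t ht).1, by rw [hFG t ht]; exact (h t ht).2⟩

theorem IsSecondOrderArc.continuousOn {F : E × E → E} {a b : ℝ} {y v : ℝ → E}
    (h : IsSecondOrderArc F a b y v) : ContinuousOn (fun t => (y t, v t)) (Icc a b) :=
  fun t ht => (h t ht).1.continuousWithinAt.prodMk (h t ht).2.continuousWithinAt

/-- Two solutions over a short time are as close as their endpoints. -/
theorem IsSecondOrderArc.norm_state_sub_le {F : E × E → E} {Λ : NNReal} (hF : LipschitzWith Λ F) {h : ℝ}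
    (h0 : 0 < h) (h1 : h ≤ 1) (hΛ : 4 * (Λ * h) ≤ 1) {y₁ v₁ y₂ v₂ : ℝ → E}
    (hx₁ : IsSecondOrderArc F 0 h y₁ v₁) (hx₂ : IsSecondOrderArc F 0 h y₂ v₂) :
    ∀ t ∈ Icc 0 h, ‖(y₁ t, v₁ t) - (y₂ t, v₂ t)‖ ≤
      4 / h * (‖y₁ 0 - y₂ 0‖ + ‖y₁ h - y₂ h‖) := by
  set δ := ‖y₁ 0 - y₂ 0‖ + ‖y₁ h - y₂ h‖ with hδ
  have hδ0 : 0 ≤ δ := by positivity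
  have hδh : δ ≤ δ / h := by rw [le_div_iff₀ h0]; nlinarith
  have hm0 : (0 : ℝ) ∈ Icc 0 h := ⟨le_rfl, h0.le⟩
  have hmh : h ∈ Icc 0 h := ⟨h0.le, le_rfl⟩
  -- The largest distance `S` of the two states is bounded by the endpoint distances plus `S / 2`,
  -- and the last term is absorbed.
  obtain ⟨τ, hτ, hmax⟩ := isCompact_Icc.exists_isMaxOn ⟨0, hm0⟩
    ((hx₁.continuousOn.sub hx₂.continuousOn).norm)
  set S := ‖(y₁ τ, v₁ τ) - (y₂ τ, v₂ τ)‖ with hS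
  have hmax' : ∀ t ∈ Icc 0 h, ‖(y₁ t, v₁ t) - (y₂ t, v₂ t)‖ ≤ S := fun t ht => hmax ht
  have hS0 : 0 ≤ S := norm_nonneg _
  have hw : ∀ t ∈ Icc 0 h, HasDerivWithinAt (fun t => y₁ t - y₂ t) (v₁ t - v₂ t) (Icc 0 h) t :=
    fun t ht => (hx₁ t ht).1.sub (hx₂ t ht).1
  have hω : ∀ t ∈ Icc 0 h, ‖(v₁ t - v₂ t) - (v₁ 0 - v₂ 0)‖ ≤ Λ * S * h := by
    intro t ht
    have := (convex_Icc 0 h).norm_image_sub_le_of_norm_hasDerivWithin_le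
      (fun t ht => (hx₁ t ht).2.sub (hx₂ t ht).2) (C := Λ * S)
      (fun t ht => (hF.norm_sub_le _ _).trans (by gcongr; exact hmax' t ht)) hm0 ht
    refine this.trans ?_
    rw [sub_zero, Real.norm_eq_abs, abs_of_nonneg ht.1]
    gcongr
    exact ht.2
  have hlin : ‖(y₁ h - y₂ h) - (y₁ 0 - y₂ 0) - h • (v₁ 0 - v₂ 0)‖ ≤ Λ * S * h * h := by
    have := (convex_Icc 0 h).norm_image_sub_le_of_norm_hasDerivWithin_le
      (f := fun t => (y₁ t - y₂ t) - t • (v₁ 0 - v₂ 0))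
      (f' := fun t => (v₁ t - v₂ t) - (v₁ 0 - v₂ 0)) (C := Λ * S * h)
      (fun t ht => by
        simpa using (hw t ht).fun_sub (((hasDerivAt_id t).smul_const (v₁ 0 - v₂ 0)).hasDerivWithinAt))
      hω hm0 hmh
    rw [sub_zero, Real.norm_eq_abs, abs_of_pos h0] at this
    refine le_trans (le_of_eq ?_) this
    congr 1
    simp
    abel
  -- The unknown difference of initial velocities is recovered from the endpoints by dividing the
  -- linearised displacement by `h`; this produces the factor `1 / h`.
  have hω0 : ‖v₁ 0 - v₂ 0‖ ≤ δ / h + Λ * S * h := by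
    have : ‖h • (v₁ 0 - v₂ 0)‖ ≤ δ + Λ * S * h * h := by
      calc _ = ‖(y₁ h - y₂ h) - (y₁ 0 - y₂ 0)
              - ((y₁ h - y₂ h) - (y₁ 0 - y₂ 0) - h • (v₁ 0 - v₂ 0))‖ := by congr 1; abel
        _ ≤ ‖(y₁ h - y₂ h) - (y₁ 0 - y₂ 0)‖ + Λ * S * h * h :=
          (norm_sub_le _ _).trans (by gcongr)
        _ ≤ _ := by
          gcongr
          rw [hδ, add_comm]
          exact norm_sub_le _ _
    rw [norm_smul, Real.norm_eq_abs, abs_of_pos h0] at this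
    rw [← mul_le_mul_iff_right₀ h0]
    refine this.trans_eq ?_
    field_simp
  have hωt : ∀ t ∈ Icc 0 h, ‖v₁ t - v₂ t‖ ≤ δ / h + 2 * (Λ * S * h) := fun t ht => by
    have := norm_add_le ((v₁ t - v₂ t) - (v₁ 0 - v₂ 0)) (v₁ 0 - v₂ 0)
    rw [sub_add_cancel] at this
    linarith [hω t ht]
  have hwt : ∀ t ∈ Icc 0 h, ‖y₁ t - y₂ t‖ ≤ δ + h * (δ / h + 2 * (Λ * S * h)) := by
    intro t ht
    have h3 := (convex_Icc 0 h).norm_image_sub_le_of_norm_hasDerivWithin_le hw hωt hm0 ht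
    rw [sub_zero, Real.norm_eq_abs, abs_of_nonneg ht.1] at h3
    have h4 := norm_add_le ((y₁ t - y₂ t) - (y₁ 0 - y₂ 0)) (y₁ 0 - y₂ 0)
    rw [sub_add_cancel] at h4
    have h5 : (δ / h + 2 * (Λ * S * h)) * t ≤ h * (δ / h + 2 * (Λ * S * h)) := by
      rw [mul_comm]
      gcongr
      exact ht.2
    have h6 : ‖y₁ 0 - y₂ 0‖ ≤ δ := by rw [hδ]; linarith [norm_nonneg (y₁ h - y₂ h)]
    linarith
  have hΛS : 2 * (Λ * S * h) ≤ S / 2 := by nlinarith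
  have hΛS0 : 0 ≤ 2 * (Λ * S * h) := by positivity
  have hfin : ∀ t ∈ Icc 0 h, ‖(y₁ t, v₁ t) - (y₂ t, v₂ t)‖ ≤ 2 * (δ / h) + S / 2 := by
    intro t ht
    rw [Prod.mk_sub_mk, Prod.norm_mk]
    refine max_le ((hwt t ht).trans ?_) ((hωt t ht).trans ?_)
    · rw [mul_add, mul_div_cancel₀ _ h0.ne']
      nlinarith
    · have : 0 ≤ δ / h := by positivity
      linarith
  have hSle : S ≤ 4 / h * δ := by
    have := hfin τ hτ
    rw [← hS] at this
    have e : 4 / h * δ = 4 * (δ / h) := by ring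
    linarith
  exact fun t ht => (hmax' t ht).trans hSle

/-- Short-time two-point boundary value problems with globally Lipschitz right-hand side are
solvable. -/
theorem exists_isSecondOrderArc [CompleteSpace E] {F : E × E → E} {Λ : NNReal}
    (hF : LipschitzWith Λ F) {h : ℝ} (h0 : 0 < h) (h1 : h ≤ 1) (hΛ : 4 * (Λ * h) ≤ 1) (z₀ z₁ : E) :
    ∃ y v : ℝ → E, IsSecondOrderArc F 0 h y v ∧ y 0 = z₀ ∧ y h = z₁ := by
  let ext : C(Icc (0 : ℝ) h, E) → ℝ → E := fun u => IccExtend h0.le u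
  have hext : ∀ u, Continuous (ext u) := fun u => u.continuous.Icc_extend'
  let I : C(Icc (0 : ℝ) h, E) → ℝ → E := fun u t => ∫ s in (0 : ℝ)..t, ext u s
  have hI : ∀ u t, HasDerivAt (I u) (ext u t) t := fun u t =>
    ((hext u).integral_hasStrictDerivAt 0 t).hasDerivAt
  have hIc : ∀ u, Continuous (I u) := fun u =>
    continuous_iff_continuousAt.2 fun t => (hI u t).continuousAt
  let J : C(Icc (0 : ℝ) h, E) → ℝ → E := fun u t => ∫ s in (0 : ℝ)..t, I u s
  have hJ : ∀ u t, HasDerivAt (J u) (I u t) t := fun u t =>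
    ((hIc u).integral_hasStrictDerivAt 0 t).hasDerivAt
  have hJc : ∀ u, Continuous (J u) := fun u =>
    continuous_iff_continuousAt.2 fun t => (hJ u t).continuousAt
  -- The unknown `u` is the acceleration, and `J u` is its double integral from `0`. The initial
  -- velocity `c u` is the one for which `y u` ends at `z₁`; a fixed point of `T` is then a
  -- solution.
  let c : C(Icc (0 : ℝ) h, E) → E := fun u => h⁻¹ • (z₁ - z₀ - J u h)
  let y : C(Icc (0 : ℝ) h, E) → ℝ → E := fun u t => z₀ + t • c u + J u t
  let v : C(Icc (0 : ℝ) h, E) → ℝ → E := fun u t => c u + I u t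
  let T : C(Icc (0 : ℝ) h, E) → C(Icc (0 : ℝ) h, E) := fun u =>
    ⟨fun t => F (y u t, v u t), by
      have := hIc u
      have := hJc u
      exact hF.continuous.comp (by fun_prop)⟩
  have hmh : h ∈ Icc 0 h := ⟨h0.le, le_rfl⟩
  have hIle : ∀ u w, ∀ t ∈ Icc 0 h, ‖I u t - I w t‖ ≤ dist u w * h := by
    intro u w t ht
    change ‖(∫ s in (0 : ℝ)..t, ext u s) - ∫ s in (0 : ℝ)..t, ext w s‖ ≤ _
    rw [← intervalIntegral.integral_sub ((hext u).intervalIntegrable _ _)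
      ((hext w).intervalIntegrable _ _)]
    refine (intervalIntegral.norm_integral_le_of_norm_le_const (C := dist u w)
      (fun s _ => ?_)).trans ?_
    · rw [← dist_eq_norm]
      exact ContinuousMap.dist_apply_le_dist _
    · rw [sub_zero, abs_of_nonneg ht.1]
      gcongr
      exact ht.2
  have hJle : ∀ u w, ∀ t ∈ Icc 0 h, ‖J u t - J w t‖ ≤ dist u w * h * h := by
    intro u w t ht
    change ‖(∫ s in (0 : ℝ)..t, I u s) - ∫ s in (0 : ℝ)..t, I w s‖ ≤ _
    rw [← intervalIntegral.integral_sub ((hIc u).intervalIntegrable _ _)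
      ((hIc w).intervalIntegrable _ _)]
    refine (intervalIntegral.norm_integral_le_of_norm_le_const (C := dist u w * h)
      (fun s hs => hIle u w s ?_)).trans ?_
    · rw [uIoc_of_le ht.1] at hs
      exact ⟨hs.1.le, hs.2.trans ht.2⟩
    · rw [sub_zero, abs_of_nonneg ht.1]
      gcongr
      exact ht.2
  have hcle : ∀ u w, ‖c u - c w‖ ≤ dist u w * h := by
    intro u w
    have e : c u - c w = h⁻¹ • (J w h - J u h) := by
      simp only [c, ← smul_sub]
      congr 1
      abel
    rw [e, norm_smul, Real.norm_eq_abs, abs_of_pos (inv_pos.2 h0), inv_mul_le_iff₀ h0, dist_comm]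
    linarith [hJle w u h hmh]
  -- Position and velocity each change by at most `2 h` times the change of `u`, so `4 Λ h ≤ 1`
  -- gives the factor `1 / 2`.
  have hT : ContractingWith (1 / 2) T := by
    refine ⟨by rw [← NNReal.coe_lt_coe]; norm_num, LipschitzWith.of_dist_le_mul fun u w => ?_⟩
    refine (ContinuousMap.dist_le (by positivity)).2 fun t => ?_
    change dist (F (y u t, v u t)) (F (y w t, v w t)) ≤ _
    have hd : dist (y u t, v u t) (y w t, v w t) ≤ 2 * (dist u w * h) := by
      rw [dist_eq_norm, Prod.mk_sub_mk, Prod.norm_mk]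
      refine max_le ?_ ?_
      · have e : y u t - y w t = (t : ℝ) • (c u - c w) + (J u t - J w t) := by
          simp only [y, smul_sub]
          abel
        rw [e]
        refine (norm_add_le _ _).trans ?_
        rw [norm_smul, Real.norm_eq_abs, abs_of_nonneg t.2.1, two_mul]
        have hd0 : 0 ≤ dist u w * h := by positivity
        refine add_le_add ?_ ((hJle u w t t.2).trans (mul_le_of_le_one_right hd0 h1))
        exact (mul_le_of_le_one_left (norm_nonneg _) (t.2.2.trans h1)).trans (hcle u w)
      · have e : v u t - v w t = (c u - c w) + (I u t - I w t) := by
          simp only [v]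
          abel
        rw [e, two_mul]
        exact (norm_add_le _ _).trans (add_le_add (hcle u w) (hIle u w t t.2))
    refine (hF.dist_le_mul _ _).trans ?_
    have : (0 : ℝ) ≤ dist u w := dist_nonneg
    calc (Λ : ℝ) * dist (y u t, v u t) (y w t, v w t) ≤ Λ * (2 * (dist u w * h)) := by gcongr
      _ = (4 * (Λ * h)) * dist u w / 2 := by ring
      _ ≤ 1 * dist u w / 2 := by gcongr
      _ = _ := by push_cast; ring
  obtain ⟨u, hu⟩ : ∃ u, T u = u := ⟨_, hT.fixedPoint_isFixedPt⟩
  refine ⟨y u, v u, fun t ht => ⟨?_, ?_⟩, by simp [y, J], ?_⟩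
  · have : HasDerivAt (y u) _ t :=
      (((hasDerivAt_id t).smul_const (c u)).const_add z₀).fun_add (hJ u t)
    simpa using this.hasDerivWithinAt (s := Icc 0 h)
  · have : F (y u t, v u t) = ext u t := by
      change _ = IccExtend h0.le u t
      rw [IccExtend_of_mem _ _ ht]
      exact congrArg (fun w : C(Icc (0 : ℝ) h, E) => w ⟨t, ht⟩) hu
    rw [this]
    exact ((hI u t).const_add (c u)).hasDerivWithinAt
  · simp only [y, c, smul_smul, mul_inv_cancel₀ h0.ne', one_smul]
    abel

end SecondOrder

/-! ### Taylor expansions along solutions of second order equations -/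

section Expansion

variable {E Y : Type*} [NormedAddCommGroup E] [NormedSpace ℝ E] [FiniteDimensional ℝ E]
  [NormedAddCommGroup Y] [NormedSpace ℝ Y] {F : E × E → E}

omit [FiniteDimensional ℝ E] in
theorem IsSecondOrderArc.hasDerivWithinAt_state {a b : ℝ} {y v : ℝ → E}
    (hx : IsSecondOrderArc F a b y v) {t : ℝ} (ht : t ∈ Icc a b) :
    HasDerivWithinAt (fun t => (y t, v t)) (v t, F (y t, v t)) (Icc a b) t :=
  (hx t ht).1.prodMk (hx t ht).2

/-- The derivative of `g` along the second order vector field of `F`. -/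
noncomputable def arcDeriv (F : E × E → E) (g : E × E → Y) (x : E × E) : Y :=
  fderiv ℝ g x (x.2, F x)

omit [FiniteDimensional ℝ E] in
theorem contDiff_arcDeriv {g : E × E → Y} {k l : WithTop ℕ∞} (hF : ContDiff ℝ l F)
    (hg : ContDiff ℝ k g) (hl : l + 1 ≤ k) : ContDiff ℝ l (arcDeriv F g) :=
  (hg.fderiv_right hl).clm_apply (contDiff_snd.prodMk hF)

omit [FiniteDimensional ℝ E] in
theorem IsSecondOrderArc.hasDerivWithinAt_comp {a b : ℝ} {y v : ℝ → E}
    (hx : IsSecondOrderArc F a b y v) {g : E × E → Y} (hg : Differentiable ℝ g) {t : ℝ}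
    (ht : t ∈ Icc a b) :
    HasDerivWithinAt (fun t => g (y t, v t)) (arcDeriv F g (y t, v t)) (Icc a b) t :=
  (hg (y t, v t)).hasFDerivAt.comp_hasDerivWithinAt t (hx.hasDerivWithinAt_state ht)

/-- Time derivatives along an arc are values of the fixed function `arcDeriv F g`, which is bounded
on `S`; hence the constant does not depend on the arc. -/
theorem exists_arc_taylor_zero (hF : ContDiff ℝ 1 F) {g : E × E → Y} (hg : ContDiff ℝ 1 g)
    {S : Set (E × E)} (hS : Bornology.IsBounded S) :
    ∃ C : ℝ, 0 ≤ C ∧ ∀ (a b : ℝ) (y v : ℝ → E), IsSecondOrderArc F a b y v →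
      (∀ t ∈ Icc a b, (y t, v t) ∈ S) → ∀ t ∈ Icc a b, ∀ s ∈ Icc a b,
        ‖g (y s, v s) - g (y t, v t)‖ ≤ C * |s - t| := by
  obtain ⟨C, hC0, hC⟩ := (contDiff_arcDeriv (l := 0) (hF.of_le (by norm_num)) hg
    (by norm_num)).continuous.exists_norm_le_of_isBounded hS
  refine ⟨C, hC0, fun a b y v hx hxS t ht s hs => ?_⟩
  have := norm_le_mul_abs_pow_succ (k := 0) hC0 ht
    (fun s hs => (hx.hasDerivWithinAt_comp (hg.differentiable one_ne_zero) hs).sub_const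
      (g (y t, v t)))
    (fun s hs => by simpa using hC _ (hxS s hs)) (by simp) s hs
  simpa using this

theorem exists_arc_taylor_one (hF : ContDiff ℝ 1 F) {g : E × E → Y} (hg : ContDiff ℝ 2 g)
    {S : Set (E × E)} (hS : Bornology.IsBounded S) :
    ∃ C : ℝ, 0 ≤ C ∧ ∀ (a b : ℝ) (y v : ℝ → E), IsSecondOrderArc F a b y v →
      (∀ t ∈ Icc a b, (y t, v t) ∈ S) → ∀ t ∈ Icc a b, ∀ s ∈ Icc a b,
        ‖g (y s, v s) - g (y t, v t) - (s - t) • arcDeriv F g (y t, v t)‖ ≤ C * |s - t| ^ 2 := by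
  obtain ⟨C, hC0, hC⟩ := exists_arc_taylor_zero hF
    (contDiff_arcDeriv (l := 1) hF hg (by norm_num)) hS
  refine ⟨C, hC0, fun a b y v hx hxS t ht s hs => ?_⟩
  refine norm_le_mul_abs_pow_succ (k := 1) hC0 ht
    (g := fun s => g (y s, v s) - g (y t, v t) - (s - t) • arcDeriv F g (y t, v t))
    (g' := fun s => arcDeriv F g (y s, v s) - arcDeriv F g (y t, v t))
    (fun s hs => ?_) (fun s hs => by simpa using hC a b y v hx hxS t ht s hs) (by simp) s hs
  have h1 := (hx.hasDerivWithinAt_comp (hg.differentiable (by norm_num)) hs).sub_const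
      (g (y t, v t))
  simpa using h1.fun_sub ((((hasDerivAt_id s).sub_const t).smul_const
    (arcDeriv F g (y t, v t))).hasDerivWithinAt)

/-- Third order Taylor expansion of the position. -/
theorem exists_arc_taylor_position (hF : ContDiff ℝ 2 F) {S : Set (E × E)}
    (hS : Bornology.IsBounded S) :
    ∃ C : ℝ, 0 ≤ C ∧ ∀ (a b : ℝ) (y v : ℝ → E), IsSecondOrderArc F a b y v →
      (∀ t ∈ Icc a b, (y t, v t) ∈ S) → ∀ t ∈ Icc a b, ∀ s ∈ Icc a b,
        ‖y s - y t - (s - t) • v t - ((s - t) ^ 2 / 2) • F (y t, v t)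
          - ((s - t) ^ 3 / 6) • arcDeriv F F (y t, v t)‖ ≤ C * |s - t| ^ 4 := by
  obtain ⟨C, hC0, hC⟩ := exists_arc_taylor_one (hF.of_le (by norm_num)) hF hS
  refine ⟨C, hC0, fun a b y v hx hxS t ht => ?_⟩
  set f := F (y t, v t)
  set j := arcDeriv F F (y t, v t)
  have d1 : ∀ s, HasDerivAt (fun s => s - t) 1 s := fun s => (hasDerivAt_id s).sub_const t
  have d2 : ∀ s, HasDerivAt (fun s => (s - t) ^ 2 / 2) (s - t) s := fun s => by
    have := ((d1 s).fun_pow 2).div_const 2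
    refine this.congr_deriv ?_
    simp
  have d3 : ∀ s, HasDerivAt (fun s => (s - t) ^ 3 / 6) ((s - t) ^ 2 / 2) s := fun s => by
    have := ((d1 s).fun_pow 3).div_const 6
    refine this.congr_deriv ?_
    simp
    ring
  -- The expansion of `F` along the arc is integrated once for the velocity and once more for the
  -- position.
  have hv := norm_le_mul_abs_pow_succ (k := 2) hC0 ht
    (g := fun s => v s - v t - (s - t) • f - ((s - t) ^ 2 / 2) • j)
    (g' := fun s => F (y s, v s) - f - (s - t) • j)
    (fun s hs => by
      simpa using ((((hx s hs).2.sub_const (v t)).fun_sub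
        ((d1 s).smul_const f).hasDerivWithinAt).fun_sub
          ((d2 s).smul_const j).hasDerivWithinAt))
    (fun s hs => hC a b y v hx hxS t ht s hs) (by simp)
  exact norm_le_mul_abs_pow_succ (k := 3) hC0 ht
    (g := fun s => y s - y t - (s - t) • v t - ((s - t) ^ 2 / 2) • f - ((s - t) ^ 3 / 6) • j)
    (g' := fun s => v s - v t - (s - t) • f - ((s - t) ^ 2 / 2) • j)
    (fun s hs => by
      simpa using (((((hx s hs).1.sub_const (y t)).fun_sub
        ((d1 s).smul_const (v t)).hasDerivWithinAt).fun_sub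
          ((d2 s).smul_const f).hasDerivWithinAt).fun_sub
            ((d3 s).smul_const j).hasDerivWithinAt))
    hv (by simp)

/-- Solutions of the initial value problem exist for a short time and stay near the initial
state. -/
theorem exists_isSecondOrderArc_initial (hF : ContDiff ℝ 1 F) (x₀ : E × E) {U : Set (E × E)}
    (hU : U ∈ 𝓝 x₀) :
    ∃ ε > 0, ∃ y v : ℝ → E, y 0 = x₀.1 ∧ v 0 = x₀.2 ∧ IsSecondOrderArc F 0 ε y v ∧
      ∀ t ∈ Icc 0 ε, (y t, v t) ∈ U := by
  have := FiniteDimensional.complete ℝ E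
  obtain ⟨r, hr, ε, hε, H⟩ :=
    ContDiffAt.exists_forall_mem_closedBall_exists_eq_forall_mem_Ioo_hasDerivAt
      (f := fun x : E × E => (x.2, F x)) (contDiff_snd.prodMk hF).contDiffAt (x₀ := x₀) 0
  obtain ⟨c, hc0, hc⟩ := H x₀ (Metric.mem_closedBall_self hr.le)
  have hcont : ContinuousAt c 0 := (hc 0 (by simp [hε])).continuousAt
  have hev : c ⁻¹' U ∈ 𝓝 (0 : ℝ) := hcont (by rwa [hc0])
  obtain ⟨δ, hδ, hδU⟩ := Metric.mem_nhds_iff.1 hev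
  have hpos : 0 < min ε δ / 2 := by positivity
  have hlt : ∀ t ∈ Icc 0 (min ε δ / 2), t < ε ∧ t < δ := fun t ht =>
    lt_min_iff.1 (ht.2.trans_lt (half_lt_self (lt_min hε hδ)))
  refine ⟨min ε δ / 2, hpos, fun t => (c t).1, fun t => (c t).2, congrArg Prod.fst hc0,
    congrArg Prod.snd hc0,
    fun t ht => ?_, fun t ht => hδU ?_⟩
  · have := hc t ⟨by linarith [ht.1], by linarith [(hlt t ht).1]⟩
    have h1 := (hasFDerivAt_fst (𝕜 := ℝ) (p := c t)).comp_hasDerivAt t this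
    have h2 := (hasFDerivAt_snd (𝕜 := ℝ) (p := c t)).comp_hasDerivAt t this
    exact ⟨h1.hasDerivWithinAt, h2.hasDerivWithinAt⟩
  · rw [Metric.mem_ball, dist_zero_right, Real.norm_eq_abs, abs_of_nonneg ht.1]
    exact (hlt t ht).2

omit [FiniteDimensional ℝ E] in
/-- Restriction of a solution to a subinterval, with the time shifted to start at `0`. -/
theorem IsSecondOrderArc.shift {T a h : ℝ} {y v : ℝ → E} (hx : IsSecondOrderArc F 0 T y v)
    (ha : 0 ≤ a) (hT : a + h ≤ T) :
    IsSecondOrderArc F 0 h (fun t => y (a + t)) (fun t => v (a + t)) := by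
  intro t ht
  have hmaps : MapsTo (fun t => a + t) (Icc 0 h) (Icc 0 T) := fun s hs =>
    ⟨by linarith [hs.1], by linarith [hs.2]⟩
  have hd : HasDerivWithinAt (fun t => a + t) 1 (Icc 0 h) t :=
    ((hasDerivAt_id t).const_add a).hasDerivWithinAt
  have h1 := (hx (a + t) (hmaps ht)).1.scomp t hd hmaps
  have h2 := (hx (a + t) (hmaps ht)).2.scomp t hd hmaps
  rw [one_smul] at h1 h2
  exact ⟨h1, h2⟩

end Expansion

/-! ### Lagrangians with invertible Legendre transform -/

section Legendre

variable {E : Type*} [NormedAddCommGroup E] [NormedSpace ℝ E]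

/-- The partial derivative `∂L/∂v`. -/
noncomputable def velocityDeriv (L : E × E → ℝ) (x : E × E) : E →L[ℝ] ℝ :=
  (fderiv ℝ L x).comp (ContinuousLinearMap.inr ℝ E E)

/-- The partial derivative `∂L/∂y`. -/
noncomputable def positionDeriv (L : E × E → ℝ) (x : E × E) : E →L[ℝ] ℝ :=
  (fderiv ℝ L x).comp (ContinuousLinearMap.inl ℝ E E)

/-- `(y, p) ↦ (y, V(y, p))` is a smooth inverse of the Legendre transform of `L`. -/
structure HasInverseLegendre (L : E × E → ℝ) (V : E × (E →L[ℝ] ℝ) → E) : Prop where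
  contDiff : ContDiff ℝ 4 L
  contDiff_inv : ContDiff ℝ 3 V
  left_inv : ∀ x, V (x.1, velocityDeriv L x) = x.2
  right_inv : ∀ y p, velocityDeriv L (y, V (y, p)) = p

/-- The acceleration prescribed by the Euler-Lagrange equations. -/
noncomputable def acceleration (L : E × E → ℝ) (V : E × (E →L[ℝ] ℝ) → E) (x : E × E) : E :=
  fderiv ℝ V (x.1, velocityDeriv L x) (x.2, positionDeriv L x)

theorem fderiv_apply_eq_add (L : E × E → ℝ) (x w : E × E) :
    fderiv ℝ L x w = positionDeriv L x w.1 + velocityDeriv L x w.2 := by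
  simp [positionDeriv, velocityDeriv, ← map_add]

theorem contDiff_velocityDeriv {L : E × E → ℝ} {k l : WithTop ℕ∞} (hL : ContDiff ℝ k L)
    (hl : l + 1 ≤ k) : ContDiff ℝ l (velocityDeriv L) :=
  (hL.fderiv_right hl).clm_comp contDiff_const

theorem contDiff_positionDeriv {L : E × E → ℝ} {k l : WithTop ℕ∞} (hL : ContDiff ℝ k L)
    (hl : l + 1 ≤ k) : ContDiff ℝ l (positionDeriv L) :=
  (hL.fderiv_right hl).clm_comp contDiff_const

theorem hasFDerivAt_velocity {L : E × E → ℝ} (hL : Differentiable ℝ L) (x : E × E) :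
    HasFDerivAt (fun w => L (x.1, w)) (velocityDeriv L x) x.2 :=
  (hL x).hasFDerivAt.comp x.2 (hasFDerivAt_prodMk_right x.1 x.2)

theorem hasFDerivAt_position {L : E × E → ℝ} (hL : Differentiable ℝ L) (x : E × E) :
    HasFDerivAt (fun z => L (z, x.2)) (positionDeriv L x) x.1 :=
  (hL x).hasFDerivAt.comp x.1 (hasFDerivAt_prodMk_left x.1 x.2)

namespace HasInverseLegendre

variable {L : E × E → ℝ} {V : E × (E →L[ℝ] ℝ) → E}

theorem contDiff_acceleration (hV : HasInverseLegendre L V) : ContDiff ℝ 2 (acceleration L V) := by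
  have h1 := contDiff_velocityDeriv (l := 2) hV.contDiff (by norm_num)
  have h2 := contDiff_positionDeriv (l := 2) hV.contDiff (by norm_num)
  exact ((hV.contDiff_inv.fderiv_right (m := 2) (by norm_num)).comp
    (contDiff_fst.prodMk h1)).clm_apply (contDiff_snd.prodMk h2)

theorem differentiable (hV : HasInverseLegendre L V) : Differentiable ℝ L :=
  hV.contDiff.differentiable (by norm_num)

theorem differentiable_velocityDeriv (hV : HasInverseLegendre L V) :
    Differentiable ℝ (velocityDeriv L) :=
  (contDiff_velocityDeriv (l := 3) hV.contDiff (by norm_num)).differentiable (by norm_num)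

/-- The Euler-Lagrange equations. -/
theorem arcDeriv_velocityDeriv (hV : HasInverseLegendre L V) (x : E × E) :
    arcDeriv (acceleration L V) (velocityDeriv L) x = positionDeriv L x := by
  -- The identity `∂L/∂v (y, V(y, p)) = p` is differentiated in the direction `(v, ∂L/∂y)`; by
  -- definition of the acceleration the inner derivative is `(v, a)`.
  have hid : (fun z : E × (E →L[ℝ] ℝ) => velocityDeriv L (z.1, V z)) = Prod.snd :=
    funext fun z => hV.right_inv z.1 z.2
  set z : E × (E →L[ℝ] ℝ) := (x.1, velocityDeriv L x) with hz
  have h1 : HasFDerivAt (fun z : E × (E →L[ℝ] ℝ) => (z.1, V z)) _ z :=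
    hasFDerivAt_fst.prodMk ((hV.contDiff_inv.differentiable (by norm_num)) z).hasFDerivAt
  have hx : (z.1, V z) = x := by rw [hz, hV.left_inv]
  have h2 := (hV.differentiable_velocityDeriv (z.1, V z)).hasFDerivAt.comp z h1
  have h3 := congrArg (fun A => A (x.2, positionDeriv L x))
    ((h2.congr_of_eventuallyEq (Eventually.of_forall fun w => (congrFun hid w).symm)).unique
      (hasFDerivAt_snd (𝕜 := ℝ) (p := z)))
  rw [hx] at h3
  exact h3

end HasInverseLegendre

end Legendre

/-! ### Euler-Lagrange arcs as solutions of a second order equation. -/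

section EulerLagrange

variable {n : ℕ} {L : Phase n × Phase n → ℝ} {V : Phase n × (Phase n →L[ℝ] ℝ) → Phase n}

/-- An Euler-Lagrange arc gives differentiability of the momentum only; that of `v = V(y, p)`, and
its derivative, follow by the chain rule for `V`. The converse is `arcDeriv_velocityDeriv`. -/
theorem HasInverseLegendre.isEulerLagrangeArc_iff (hV : HasInverseLegendre L V) {a b : ℝ}
    {y v : ℝ → Phase n} :
    IsEulerLagrangeArc L a b y v ↔ IsSecondOrderArc (acceleration L V) a b y v := by
  have e1 : ∀ s, fderiv ℝ (fun w => L (y s, w)) (v s) = velocityDeriv L (y s, v s) := fun s =>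
    (hasFDerivAt_velocity hV.differentiable (y s, v s)).fderiv
  have e2 : ∀ s, fderiv ℝ (fun z => L (z, v s)) (y s) = positionDeriv L (y s, v s) := fun s =>
    (hasFDerivAt_position hV.differentiable (y s, v s)).fderiv
  simp only [IsEulerLagrangeArc, e1, e2]
  constructor
  · intro h t ht
    refine ⟨(h t ht).1, ?_⟩
    have := ((hV.contDiff_inv.differentiable (by norm_num))
      (y t, velocityDeriv L (y t, v t))).hasFDerivAt.comp_hasDerivWithinAt t
        ((h t ht).1.prodMk (h t ht).2)
    refine this.congr_of_mem (fun s _ => (hV.left_inv (y s, v s)).symm) ht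
  · intro h t ht
    refine ⟨(h t ht).1, ?_⟩
    have := h.hasDerivWithinAt_comp hV.differentiable_velocityDeriv ht
    rwa [hV.arcDeriv_velocityDeriv] at this

/-! ### The exact discrete Lagrangian -/

theorem isConnectingArc_self {W : Set (Phase n × Phase n)} {h : ℝ} {y v : ℝ → Phase n}
    (hx : IsEulerLagrangeArc L 0 h y v) (hW : ∀ t ∈ Icc 0 h, (y t, v t) ∈ W) :
    IsConnectingArc L W (y 0) (y h) h y v := ⟨hx, rfl, rfl, hW⟩

/-- Uniqueness makes the arbitrary choice in the definition harmless. -/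
theorem exactDiscreteLagrangian_eq {W : Set (Phase n × Phase n)} {y₀ y₁ : Phase n} {h : ℝ}
    (h0 : 0 ≤ h) {y v : ℝ → Phase n} (hx : IsConnectingArc L W y₀ y₁ h y v)
    (huniq : ∀ y₂ v₂ : ℝ → Phase n, IsConnectingArc L W y₀ y₁ h y₂ v₂ →
      EqOn y₂ y (Icc 0 h) ∧ EqOn v₂ v (Icc 0 h)) :
    exactDiscreteLagrangian L W y₀ y₁ h = ∫ t in (0 : ℝ)..h, L (y t, v t) := by
  have hex : ∃ c : (ℝ → Phase n) × (ℝ → Phase n), IsConnectingArc L W y₀ y₁ h c.1 c.2 :=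
    ⟨(y, v), hx⟩
  rw [exactDiscreteLagrangian, dif_pos hex]
  have hu := huniq _ _ hex.choose_spec
  refine intervalIntegral.integral_congr fun t ht => ?_
  rw [uIcc_of_le h0] at ht
  simp only [hu.1 ht, hu.2 ht]

/-- Along a solution the first variation of the action reduces to boundary terms, up to an error
that is quadratic in the variation. -/
theorem HasInverseLegendre.abs_action_sub_le (hV : HasInverseLegendre L V) {h C δ : ℝ} (h0 : 0 ≤ h)
    {y v y' v' : ℝ → Phase n} (hx : IsSecondOrderArc (acceleration L V) 0 h y v)
    (hx' : IsSecondOrderArc (acceleration L V) 0 h y' v') (hC0 : 0 ≤ C)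
    (hC : ∀ t ∈ Icc 0 h, ‖L (y' t, v' t) - L (y t, v t)
      - fderiv ℝ L (y t, v t) ((y' t, v' t) - (y t, v t))‖ ≤ C * ‖(y' t, v' t) - (y t, v t)‖ ^ 2)
    (hδ : ∀ t ∈ Icc 0 h, ‖(y' t, v' t) - (y t, v t)‖ ≤ δ) :
    |(∫ t in (0 : ℝ)..h, L (y' t, v' t)) - (∫ t in (0 : ℝ)..h, L (y t, v t))
      - (velocityDeriv L (y h, v h) (y' h - y h) - velocityDeriv L (y 0, v 0) (y' 0 - y 0))|
      ≤ C * δ ^ 2 * h := by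
  have hLc := hV.contDiff.continuous
  have hc := hx.continuousOn
  have hc' := hx'.continuousOn
  have hi : ∀ f : ℝ → ℝ, ContinuousOn f (Icc 0 h) →
      IntervalIntegrable f MeasureTheory.volume 0 h := fun f hf =>
    (by rwa [uIcc_of_le h0] : ContinuousOn f (uIcc 0 h)).intervalIntegrable
  have hi1 := hi (fun t => L (y t, v t)) (hLc.comp_continuousOn hc)
  have hi2 := hi (fun t => L (y' t, v' t)) (hLc.comp_continuousOn hc')
  have hcD : ContinuousOn (fun t => fderiv ℝ L (y t, v t) ((y' t, v' t) - (y t, v t))) (Icc 0 h) :=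
    ((hV.contDiff.continuous_fderiv (by norm_num)).comp_continuousOn hc).clm_apply (hc'.sub hc)
  -- Integration by parts in differential form: since `p' = ∂L/∂y` and `(y' - y)` has derivative `v'
  -- - v`, the linear part of the variation is the derivative of `p (y' - y)`.
  have hder : ∀ t ∈ Icc 0 h, HasDerivWithinAt (fun t => velocityDeriv L (y t, v t) (y' t - y t))
      (fderiv ℝ L (y t, v t) ((y' t, v' t) - (y t, v t))) (Icc 0 h) t := by
    intro t ht
    have h1 := hx.hasDerivWithinAt_comp hV.differentiable_velocityDeriv ht
    rw [hV.arcDeriv_velocityDeriv] at h1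
    rw [fderiv_apply_eq_add]
    exact h1.clm_apply ((hx' t ht).1.sub (hx t ht).1)
  have hftc := intervalIntegral.integral_eq_sub_of_hasDerivAt_of_le h0
    (fun t ht => (hder t ht).continuousWithinAt)
    (fun t ht => (hder t (Ioo_subset_Icc_self ht)).hasDerivAt (Icc_mem_nhds ht.1 ht.2))
    (hi _ hcD)
  rw [← hftc, ← intervalIntegral.integral_sub hi2 hi1,
    ← intervalIntegral.integral_sub (hi2.sub hi1) (hi _ hcD)]
  have := intervalIntegral.norm_integral_le_of_norm_le_const (a := 0) (b := h) (C := C * δ ^ 2)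
    (f := fun t => L (y' t, v' t) - L (y t, v t)
      - fderiv ℝ L (y t, v t) ((y' t, v' t) - (y t, v t))) (fun t ht => ?_)
  · rwa [sub_zero, abs_of_nonneg h0] at this
  · rw [uIoc_of_le h0] at ht
    have ht' := Ioc_subset_Icc_self ht
    refine (hC t ht').trans ?_
    gcongr
    exact hδ t ht'

/-- For short time steps, nearby endpoints are joined by exactly one solution in `W`, the exact
discrete Lagrangian is the action of that solution, and its derivatives are the momenta at the
endpoints. -/
theorem HasInverseLegendre.exists_exactDiscreteLagrangian (hV : HasInverseLegendre L V)
    {W : Set (Phase n × Phase n)} (hWo : IsOpen W) (hWb : Bornology.IsBounded W) :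
    ∃ h₀ > 0, h₀ ≤ 1 ∧ ∀ h : ℝ, 0 < h → h ≤ h₀ → ∀ y v : ℝ → Phase n,
      IsSecondOrderArc (acceleration L V) 0 h y v → (∀ t ∈ Icc 0 h, (y t, v t) ∈ W) →
        (∀ᶠ z in 𝓝 (y 0, y h), ∃ y₁ v₁ : ℝ → Phase n,
          IsConnectingArc L W z.1 z.2 h y₁ v₁ ∧
          ∀ y₂ v₂ : ℝ → Phase n, IsConnectingArc L W z.1 z.2 h y₂ v₂ →
            EqOn y₂ y₁ (Icc 0 h) ∧ EqOn v₂ v₁ (Icc 0 h)) ∧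
        exactDiscreteLagrangian L W (y 0) (y h) h = (∫ t in (0 : ℝ)..h, L (y t, v t)) ∧
        HasFDerivAt (fun z : Phase n × Phase n => exactDiscreteLagrangian L W z.1 z.2 h)
          ((velocityDeriv L (y h, v h)).comp (ContinuousLinearMap.snd ℝ (Phase n) (Phase n))
            - (velocityDeriv L (y 0, v 0)).comp (ContinuousLinearMap.fst ℝ (Phase n) (Phase n)))
          (y 0, y h) := by
  obtain ⟨G, Λ, hG, hGF⟩ := (hV.contDiff_acceleration.of_le (by norm_num :
    (1 : WithTop ℕ∞) ≤ 2)).exists_lipschitzWith_eqOn hWb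
  obtain ⟨C, hC0, hC⟩ := (hV.contDiff.of_le (by norm_num :
    (2 : WithTop ℕ∞) ≤ 4)).exists_norm_sub_fderiv_le_of_isBounded hWb
  have hΛ0 : (0 : ℝ) ≤ Λ := Λ.2
  -- This bound on `h` yields `h ≤ 1` and `4 Λ h ≤ 1`, also when `Λ = 0`.
  refine ⟨min 1 (1 / (4 * (Λ + 1))), by positivity, min_le_left _ _, fun h h0 hh y v hx hxW => ?_⟩
  have h1 : h ≤ 1 := hh.trans (min_le_left _ _)
  have hΛ : 4 * (Λ * h) ≤ 1 := by
    have := hh.trans (min_le_right _ _)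
    rw [le_div_iff₀ (by positivity)] at this
    nlinarith
  have hconv : ∀ {y v : ℝ → Phase n}, IsSecondOrderArc (acceleration L V) 0 h y v →
      (∀ t ∈ Icc 0 h, (y t, v t) ∈ W) → IsSecondOrderArc G 0 h y v := fun hx hW =>
    hx.congr fun t ht => hGF _ (hW t ht)
  have huniq : ∀ (z : Phase n × Phase n) (y₁ v₁ y₂ v₂ : ℝ → Phase n),
      IsConnectingArc L W z.1 z.2 h y₁ v₁ → IsConnectingArc L W z.1 z.2 h y₂ v₂ →
        EqOn y₂ y₁ (Icc 0 h) ∧ EqOn v₂ v₁ (Icc 0 h) := by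
    intro z y₁ v₁ y₂ v₂ hx₁ hx₂
    have key := (hconv (hV.isEulerLagrangeArc_iff.1 hx₂.1) hx₂.2.2.2).norm_state_sub_le hG h0 h1 hΛ
      (hconv (hV.isEulerLagrangeArc_iff.1 hx₁.1) hx₁.2.2.2)
    rw [hx₂.2.1, hx₁.2.1, hx₂.2.2.1, hx₁.2.2.1] at key
    have heq : ∀ t ∈ Icc 0 h, (y₂ t, v₂ t) = (y₁ t, v₁ t) := fun t ht =>
      sub_eq_zero.1 (norm_le_zero_iff.1 ((key t ht).trans_eq (by simp)))
    exact ⟨fun t ht => congrArg Prod.fst (heq t ht), fun t ht => congrArg Prod.snd (heq t ht)⟩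
  -- A tube around the given arc lies in `W`. Solutions of the truncated equation with nearby
  -- endpoints stay in this tube, where the truncation changes nothing, so they are genuine
  -- Euler-Lagrange arcs.
  obtain ⟨ε, hε, hεW⟩ := (isCompact_Icc.image_of_continuousOn hx.continuousOn :
    IsCompact ((fun t => (y t, v t)) '' Icc 0 h)).exists_thickening_subset_open hWo
      (by rintro _ ⟨t, ht, rfl⟩; exact hxW t ht)
  have hnear : ∀ᶠ z in 𝓝 (y 0, y h), ∃ y₁ v₁ : ℝ → Phase n, IsConnectingArc L W z.1 z.2 h y₁ v₁ ∧
      ∀ t ∈ Icc 0 h, ‖(y₁ t, v₁ t) - (y t, v t)‖ ≤ 8 / h * ‖z - (y 0, y h)‖ := by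
    have hball : ∀ᶠ z in 𝓝 (y 0, y h), 8 / h * ‖z - (y 0, y h)‖ < ε := by
      have : Continuous fun z : Phase n × Phase n => 8 / h * ‖z - (y 0, y h)‖ := by fun_prop
      exact this.continuousAt.eventually_lt_const (by simpa using hε)
    filter_upwards [hball] with z hz
    obtain ⟨y₁, v₁, hx₁, hy0, hyh⟩ := exists_isSecondOrderArc hG h0 h1 hΛ z.1 z.2
    have hle : ∀ t ∈ Icc 0 h, ‖(y₁ t, v₁ t) - (y t, v t)‖ ≤ 8 / h * ‖z - (y 0, y h)‖ := by
      intro t ht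
      refine (hx₁.norm_state_sub_le hG h0 h1 hΛ (hconv hx hxW) t ht).trans ?_
      rw [hy0, hyh]
      have e1 := norm_fst_le (z - (y 0, y h))
      have e2 := norm_snd_le (z - (y 0, y h))
      calc _ ≤ 4 / h * (‖z - (y 0, y h)‖ + ‖z - (y 0, y h)‖) := by
            gcongr
            · exact e1
            · exact e2
        _ = _ := by ring
    have hW₁ : ∀ t ∈ Icc 0 h, (y₁ t, v₁ t) ∈ W := fun t ht => hεW
      (Metric.mem_thickening_iff.2 ⟨_, ⟨t, ht, rfl⟩, by
        rw [dist_eq_norm]; exact (hle t ht).trans_lt hz⟩)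
    exact ⟨y₁, v₁, ⟨hV.isEulerLagrangeArc_iff.2
      (hx₁.congr fun t ht => (hGF _ (hW₁ t ht)).symm), hy0, hyh, hW₁⟩, hle⟩
  have hself := isConnectingArc_self (hV.isEulerLagrangeArc_iff.2 hx) hxW
  have hval := exactDiscreteLagrangian_eq h0.le hself fun y₂ v₂ h₂ =>
    huniq (y 0, y h) _ _ _ _ hself h₂
  refine ⟨?_, hval, ?_⟩
  · filter_upwards [hnear] with z hz
    obtain ⟨y₁, v₁, hx₁, -⟩ := hz
    exact ⟨y₁, v₁, hx₁, fun y₂ v₂ h₂ => huniq z _ _ _ _ hx₁ h₂⟩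
  · set A := (velocityDeriv L (y h, v h)).comp (ContinuousLinearMap.snd ℝ (Phase n) (Phase n))
      - (velocityDeriv L (y 0, v 0)).comp (ContinuousLinearMap.fst ℝ (Phase n) (Phase n)) with hA
    -- For fixed `h`, states move by at most `8 / h` times the endpoint displacement, so the
    -- quadratic error of the first variation is quadratic in `z - (y 0, y h)`, which gives
    -- differentiability.
    have hO : (fun z : Phase n × Phase n => exactDiscreteLagrangian L W z.1 z.2 h
        - exactDiscreteLagrangian L W (y 0) (y h) h - A (z - (y 0, y h)))
        =O[𝓝 (y 0, y h)] fun z => ‖z - (y 0, y h)‖ ^ 2 := by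
      refine Asymptotics.IsBigO.of_bound (C * (8 / h) ^ 2 * h) ?_
      filter_upwards [hnear] with z hz
      obtain ⟨y₁, v₁, hx₁, hle⟩ := hz
      rw [exactDiscreteLagrangian_eq h0.le hx₁ (fun y₂ v₂ h₂ => huniq z _ _ _ _ hx₁ h₂), hval]
      have := hV.abs_action_sub_le h0.le hx (hV.isEulerLagrangeArc_iff.1 hx₁.1) hC0
        (fun t ht => hC _ (hxW t ht) _ (hx₁.2.2.2 t ht)) hle
      rw [hx₁.2.1, hx₁.2.2.1] at this
      rw [Real.norm_eq_abs, Real.norm_of_nonneg (by positivity : 0 ≤ ‖z - (y 0, y h)‖ ^ 2)]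
      refine le_trans (le_of_eq ?_) (this.trans_eq (by ring))
      simp [hA]
    have h1 := (hO.hasFDerivAt (by norm_num)).add (A.hasFDerivAt (x := (y 0, y h)))
    have h2 := h1.add_const (exactDiscreteLagrangian L W (y 0) (y h) h - A (y 0, y h))
    rw [zero_add] at h2
    refine h2.congr_of_eventuallyEq (Eventually.of_forall fun z => ?_)
    simp only [Pi.add_apply, map_sub]
    ring

theorem HasInverseLegendre.exactDiscreteLagrangianWellDefined (hV : HasInverseLegendre L V) :
    ExactDiscreteLagrangianWellDefined L := by
  intro W K hWo hWb _ hKW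
  obtain ⟨h₀, hh₀, -, H⟩ := hV.exists_exactDiscreteLagrangian hWo hWb
  refine ⟨h₀, hh₀, fun h h0 hh y v hx hxK => ?_⟩
  obtain ⟨h1, -, h3⟩ := H h h0 hh y v (hV.isEulerLagrangeArc_iff.1 hx) fun t ht => hKW (hxK t ht)
  exact ⟨h1, h3.differentiableAt⟩

end EulerLagrange

/-! ### Functions of the discrete velocity along arcs -/

section AlongArc

variable {E Y : Type*} [NormedAddCommGroup E] [NormedSpace ℝ E] [NormedAddCommGroup Y]
  [NormedSpace ℝ Y] {F : E × E → E}

/-- `g(y, p, s)` with `p` replaced by the Taylor polynomial `v + s a / 2 + s² j / 6` of the discrete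
velocity. -/
noncomputable def alongJet (g : (E × E) × ℝ → Y) (z : ((E × E) × (E × E)) × ℝ) : Y :=
  g ((z.1.1.1, z.1.1.2 + (z.2 / 2) • z.1.2.1 + (z.2 ^ 2 / 6) • z.1.2.2), z.2)

/-- The position and its first three derivatives along a solution. -/
noncomputable def solutionJet (F : E × E → E) (x : E × E) : (E × E) × (E × E) :=
  (x, (F x, arcDeriv F F x))

theorem contDiff_alongJet {g : (E × E) × ℝ → Y} {k : WithTop ℕ∞} (hg : ContDiff ℝ k g) :
    ContDiff ℝ k (alongJet g) :=
  hg.comp (by fun_prop)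

omit [NormedAddCommGroup Y] [NormedSpace ℝ Y] in
theorem alongJet_zero (g : (E × E) × ℝ → Y) (z : (E × E) × (E × E)) :
    alongJet g (z, 0) = g (z.1, 0) := by
  simp [alongJet]

variable [FiniteDimensional ℝ E]

theorem isBounded_image_solutionJet (hF : ContDiff ℝ 2 F) {S : Set (E × E)}
    (hS : Bornology.IsBounded S) : Bornology.IsBounded (solutionJet F '' S) := by
  have hc : Continuous (solutionJet F) := continuous_id.prodMk (hF.continuous.prodMk
    (contDiff_arcDeriv (l := 1) (hF.of_le (by norm_num)) hF (by norm_num)).continuous)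
  obtain ⟨C, -, hC⟩ := hc.exists_norm_le_of_isBounded hS
  exact isBounded_iff_forall_norm_le.2 ⟨C, by rintro _ ⟨x, hx, rfl⟩; exact hC x hx⟩

/-- The difference quotient agrees with its Taylor polynomial up to `O(s³)`. Replacing it by the
polynomial turns the expression into a function of jet and step that is smooth through `s = 0`, to
which the uniform Taylor estimates apply. -/
theorem exists_norm_sub_alongJet_le (hF : ContDiff ℝ 2 F) {g : (E × E) × ℝ → Y}
    (hg : ContDiff ℝ 1 g) {S : Set (E × E)} (hS : Bornology.IsBounded S) :
    ∃ C : ℝ, 0 ≤ C ∧ ∀ (a b : ℝ) (y v : ℝ → E), IsSecondOrderArc F a b y v →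
      (∀ t ∈ Icc a b, (y t, v t) ∈ S) → ∀ t ∈ Icc a b, ∀ s, t + s ∈ Icc a b → s ≠ 0 → |s| ≤ 1 →
        ‖g ((y t, s⁻¹ • (y (t + s) - y t)), s) - alongJet g (solutionJet F (y t, v t), s)‖
          ≤ C * |s| ^ 3 := by
  obtain ⟨D, hD0, hD⟩ := exists_arc_taylor_position hF hS
  have hc : Continuous fun z : ((E × E) × (E × E)) × ℝ =>
      (z.1.1.1, z.1.1.2 + (z.2 / 2) • z.1.2.1 + (z.2 ^ 2 / 6) • z.1.2.2) := by fun_prop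
  obtain ⟨M, hM0, hM⟩ := hc.exists_norm_le_of_isBounded
    ((isBounded_image_solutionJet hF hS).prod (Metric.isBounded_Icc (-1 : ℝ) 1))
  -- The polynomial point has norm at most `M`, and for `|s| ≤ 1` the true point is within `D` of
  -- it; the ball of radius `M + D` contains both.
  obtain ⟨C, hC0, hC⟩ := hg.exists_lipschitz_of_isBounded one_ne_zero
    ((Metric.isBounded_closedBall (x := (0 : E × E)) (r := M + D)).prod
      (Metric.isBounded_Icc (-1 : ℝ) 1))
  refine ⟨C * D, by positivity, fun a b y v hx hxS t ht s hts hs0 hs1 => ?_⟩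
  have hsI : s ∈ Icc (-1 : ℝ) 1 := abs_le.1 hs1
  set x := (y t, v t)
  set p := s⁻¹ • (y (t + s) - y t)
  set q := v t + (s / 2) • F x + (s ^ 2 / 6) • arcDeriv F F x
  have hpq : ‖p - q‖ ≤ D * |s| ^ 3 := by
    have h1 := hD a b y v hx hxS t ht (t + s) hts
    rw [add_sub_cancel_left] at h1
    have e : p - q = s⁻¹ • (y (t + s) - y t - s • v t - (s ^ 2 / 2) • F x
        - (s ^ 3 / 6) • arcDeriv F F x) := by
      simp only [p, q, smul_sub, smul_smul]
      rw [inv_mul_cancel₀ hs0, show s⁻¹ * (s ^ 2 / 2) = s / 2 by field_simp,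
        show s⁻¹ * (s ^ 3 / 6) = s ^ 2 / 6 by field_simp, one_smul]
      abel
    rw [e, norm_smul, norm_inv, Real.norm_eq_abs, inv_mul_le_iff₀ (abs_pos.2 hs0)]
    exact h1.trans_eq (by ring)
  have hqM : ‖(y t, q)‖ ≤ M := hM (solutionJet F x, s) ⟨mem_image_of_mem _ (hxS t ht), hsI⟩
  have hs3 : |s| ^ 3 ≤ 1 := pow_le_one₀ (abs_nonneg s) hs1
  have hpM : ‖(y t, p)‖ ≤ M + D := by
    have : (y t, p) = (y t, q) + (0, p - q) := by simp
    rw [this]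
    refine (norm_add_le _ _).trans (add_le_add hqM ?_)
    rw [Prod.norm_mk, norm_zero, max_eq_right (norm_nonneg _)]
    exact hpq.trans (mul_le_of_le_one_right hD0 hs3)
  have := hC ((y t, p), s) ⟨mem_closedBall_zero_iff.2 hpM, hsI⟩ ((y t, q), s)
    ⟨mem_closedBall_zero_iff.2 (by linarith), hsI⟩
  refine this.trans ?_
  rw [mul_assoc]
  gcongr
  simpa [Prod.norm_def] using hpq

/-- First order expansion of a function of the discrete velocity. -/
theorem exists_discrete_taylor_one (hF : ContDiff ℝ 2 F) {g : (E × E) × ℝ → Y}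
    (hg : ContDiff ℝ 2 g) {S : Set (E × E)} (hS : Bornology.IsBounded S) :
    ∃ C : ℝ, 0 ≤ C ∧ ∀ (a b : ℝ) (y v : ℝ → E), IsSecondOrderArc F a b y v →
      (∀ t ∈ Icc a b, (y t, v t) ∈ S) → ∀ t ∈ Icc a b, ∀ s, t + s ∈ Icc a b → s ≠ 0 → |s| ≤ 1 →
        ‖g ((y t, s⁻¹ • (y (t + s) - y t)), s) - g ((y t, v t), 0)
          - s • timeDeriv (alongJet g) (solutionJet F (y t, v t), 0)‖ ≤ C * |s| ^ 2 := by
  obtain ⟨C, hC0, hC⟩ := exists_norm_sub_alongJet_le hF (hg.of_le (by norm_num)) hS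
  obtain ⟨D, hD0, hD⟩ := exists_taylor_one (contDiff_alongJet hg)
    (isBounded_image_solutionJet hF hS)
  refine ⟨C + D, by positivity, fun a b y v hx hxS t ht s hts hs0 hs1 => ?_⟩
  have h1 := hC a b y v hx hxS t ht s hts hs0 hs1
  have h2 := hD _ (mem_image_of_mem _ (hxS t ht)) s (abs_le.1 hs1)
  rw [alongJet_zero] at h2
  have h3 : C * |s| ^ 3 ≤ C * |s| ^ 2 := by
    gcongr C * ?_
    exact pow_le_pow_of_le_one (abs_nonneg s) hs1 (by norm_num)
  rw [add_mul]
  refine le_trans (le_of_eq ?_) ((norm_add_le _ _).trans (add_le_add (h1.trans h3) h2))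
  congr 1
  rw [solutionJet]
  abel

/-- Forward and backward discrete velocities at the same point. -/
theorem exists_discrete_taylor_odd (hF : ContDiff ℝ 2 F) {g : (E × E) × ℝ → Y}
    (hg : ContDiff ℝ 3 g) {S : Set (E × E)} (hS : Bornology.IsBounded S) :
    ∃ C : ℝ, 0 ≤ C ∧ ∀ (a b : ℝ) (y v : ℝ → E), IsSecondOrderArc F a b y v →
      (∀ t ∈ Icc a b, (y t, v t) ∈ S) → ∀ t ∈ Icc a b, ∀ s, t + s ∈ Icc a b → t + -s ∈ Icc a b →
        s ≠ 0 → |s| ≤ 1 →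
        ‖g ((y t, s⁻¹ • (y (t + s) - y t)), s) - g ((y t, (-s)⁻¹ • (y (t + -s) - y t)), -s)
          - (2 * s) • timeDeriv (alongJet g) (solutionJet F (y t, v t), 0)‖ ≤ C * |s| ^ 3 := by
  obtain ⟨C, hC0, hC⟩ := exists_norm_sub_alongJet_le hF (hg.of_le (by norm_num)) hS
  obtain ⟨D, hD0, hD⟩ := exists_taylor_odd (contDiff_alongJet hg)
    (isBounded_image_solutionJet hF hS)
  refine ⟨C + C + D, by positivity, fun a b y v hx hxS t ht s hts hts' hs0 hs1 => ?_⟩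
  have h1 := hC a b y v hx hxS t ht s hts hs0 hs1
  have h1' := hC a b y v hx hxS t ht (-s) hts' (neg_ne_zero.2 hs0) (by rwa [abs_neg])
  have h2 := hD _ (mem_image_of_mem _ (hxS t ht)) s (abs_le.1 hs1)
  rw [abs_neg] at h1'
  rw [add_mul, add_mul]
  refine le_trans (le_of_eq ?_) ((norm_add_le _ _).trans
    (add_le_add ((norm_sub_le _ _).trans (add_le_add h1 h1')) h2))
  congr 1
  abel

-- The evaluation point lies a fraction `β` of the step away from `y`. To first order it moves by `β
-- v`, while the discrete velocity changes by half the acceleration.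
omit [FiniteDimensional ℝ E] in
theorem hasDerivAt_alongJet_point (z : (E × E) × (E × E)) (β : ℝ) :
    HasDerivAt (fun s : ℝ => (z.1.1 + (β * s) • (z.1.2 + (s / 2) • z.2.1 + (s ^ 2 / 6) • z.2.2),
      z.1.2 + (s / 2) • z.2.1 + (s ^ 2 / 6) • z.2.2)) (β • z.1.2, (1 / 2 : ℝ) • z.2.1) 0 := by
  have h1 : HasDerivAt (fun s : ℝ => s / 2) (1 / 2) 0 := (hasDerivAt_id (0 : ℝ)).div_const 2
  have h2 : HasDerivAt (fun s : ℝ => s ^ 2 / 6) 0 0 := by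
    simpa using ((hasDerivAt_id (0 : ℝ)).fun_pow 2).div_const 6
  have h3 : HasDerivAt (fun s : ℝ => β * s) β 0 := by
    simpa using (hasDerivAt_id (0 : ℝ)).const_mul β
  have h4 : HasDerivAt (fun s : ℝ => z.1.2 + (s / 2) • z.2.1 + (s ^ 2 / 6) • z.2.2)
      ((1 / 2 : ℝ) • z.2.1) 0 := by
    simpa using ((h1.smul_const z.2.1).const_add z.1.2).fun_add (h2.smul_const z.2.2)
  have h5 := (h3.fun_smul h4).const_add z.1.1
  simpa using h5.prodMk h4

omit [FiniteDimensional ℝ E] in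
theorem hasDerivAt_comp_alongJet_point {f : E × E → Y} (hf : Differentiable ℝ f)
    (z : (E × E) × (E × E)) (β : ℝ) :
    HasDerivAt (fun s : ℝ => f (z.1.1 + (β * s) • (z.1.2 + (s / 2) • z.2.1 + (s ^ 2 / 6) • z.2.2),
      z.1.2 + (s / 2) • z.2.1 + (s ^ 2 / 6) • z.2.2))
      (fderiv ℝ f z.1 (β • z.1.2, (1 / 2 : ℝ) • z.2.1)) 0 := by
  exact (hf z.1).hasFDerivAt.comp_hasDerivAt_of_eq 0 (hasDerivAt_alongJet_point z β) (by simp)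

end AlongArc

/-! ### The low-order discrete Lagrangian and its momenta -/

section LowOrder

variable {E : Type*} [NormedAddCommGroup E] [NormedSpace ℝ E]

/-- The low-order discrete Lagrangian divided by the step size, in terms of the first endpoint `y`,
the discrete velocity `p` and the step size. -/
def averagedLagrangian (L : E × E → ℝ) (α γ : ℝ) (q : (E × E) × ℝ) : ℝ :=
  α * L (q.1.1 + ((1 - γ) * q.2) • q.1.2, q.1.2) + (1 - α) * L (q.1.1 + (γ * q.2) • q.1.2, q.1.2)

/-- The derivative of the low-order discrete Lagrangian in its first endpoint. -/
noncomputable def discreteMomentum (L : E × E → ℝ) (α γ : ℝ) (q : (E × E) × ℝ) : E →L[ℝ] ℝ :=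
  (q.2 * (α * γ)) • positionDeriv L (q.1.1 + ((1 - γ) * q.2) • q.1.2, q.1.2)
    + (q.2 * ((1 - α) * (1 - γ))) • positionDeriv L (q.1.1 + (γ * q.2) • q.1.2, q.1.2)
    - α • velocityDeriv L (q.1.1 + ((1 - γ) * q.2) • q.1.2, q.1.2)
    - (1 - α) • velocityDeriv L (q.1.1 + (γ * q.2) • q.1.2, q.1.2)

theorem contDiff_averagedLagrangian {L : E × E → ℝ} {k : WithTop ℕ∞} (hL : ContDiff ℝ k L)
    (α γ : ℝ) : ContDiff ℝ k (averagedLagrangian L α γ) := by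
  unfold averagedLagrangian
  fun_prop

theorem contDiff_discreteMomentum {L : E × E → ℝ} {k l : WithTop ℕ∞} (hL : ContDiff ℝ k L)
    (hl : l + 1 ≤ k) (α γ : ℝ) : ContDiff ℝ l (discreteMomentum L α γ) := by
  have h1 := contDiff_positionDeriv hL hl
  have h2 := contDiff_velocityDeriv hL hl
  unfold discreteMomentum
  fun_prop

/-- Symmetric choices of the parameters give a time-reversible discretisation. -/
theorem discreteMomentum_one_sub (L : E × E → ℝ) {α γ : ℝ} (h : α = 1 / 2 ∨ γ = 1 / 2) :
    discreteMomentum L (1 - α) γ = discreteMomentum L α γ := by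
  funext q
  rcases h with rfl | rfl
  · norm_num
  · simp only [discreteMomentum]
    norm_num
    module

theorem discreteMomentum_zero (L : E × E → ℝ) (α γ : ℝ) (x : E × E) :
    discreteMomentum L α γ (x, 0) = -velocityDeriv L x := by
  simp only [discreteMomentum, mul_zero, zero_mul, zero_smul, add_zero]
  module

theorem averagedLagrangian_zero (L : E × E → ℝ) (α γ : ℝ) (x : E × E) :
    averagedLagrangian L α γ (x, 0) = L x := by
  simp only [averagedLagrangian, mul_zero, zero_smul, add_zero]
  ring

variable {L : E × E → ℝ} {V : E × (E →L[ℝ] ℝ) → E}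

/-- The mean position fraction is `α (1 - γ) + (1 - α) γ = 1/2 - κ`. The part `1/2` matches the
Taylor expansion of the action, and `-κ` is the error. -/
theorem timeDeriv_averagedLagrangian (hV : HasInverseLegendre L V) (α γ : ℝ) (x : E × E) (j : E) :
    timeDeriv (alongJet (averagedLagrangian L α γ)) ((x, (acceleration L V x, j)), 0)
      = (1 / 2) * arcDeriv (acceleration L V) L x
        - (1 - 2 * α) * (1 - 2 * γ) / 2 * positionDeriv L x x.2 := by
  have hd := hasDerivAt_timeDeriv ((contDiff_alongJet
    (contDiff_averagedLagrangian hV.contDiff α γ)).differentiable (by norm_num))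
    (x, (acceleration L V x, j)) 0
  refine hd.unique ?_
  have h := fun β => hasDerivAt_comp_alongJet_point hV.differentiable (x, (acceleration L V x, j)) β
  have h1 := ((h (1 - γ)).const_mul α).fun_add ((h γ).const_mul (1 - α))
  refine h1.congr_deriv ?_
  simp only [arcDeriv, fderiv_apply_eq_add, map_smul, smul_eq_mul]
  ring

/-- The position terms carry total weight `αγ + (1 - α)(1 - γ) = 1/2 + κ`, the velocity terms the
mean fraction `1/2 - κ`. The halves cancel by the Euler-Lagrange equations and only multiples of `κ`
remain. -/
theorem timeDeriv_discreteMomentum (hV : HasInverseLegendre L V) (α γ : ℝ) (x : E × E) (j : E) :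
    timeDeriv (alongJet (discreteMomentum L α γ)) ((x, (acceleration L V x, j)), 0)
      = ((1 - 2 * α) * (1 - 2 * γ) / 2) •
        (positionDeriv L x + fderiv ℝ (velocityDeriv L) x (x.2, 0)) := by
  have hd := hasDerivAt_timeDeriv ((contDiff_alongJet
    (contDiff_discreteMomentum (l := 3) hV.contDiff (by norm_num) α γ)).differentiable
      (by norm_num)) (x, (acceleration L V x, j)) 0
  refine hd.unique ?_
  have hp : Differentiable ℝ (positionDeriv L) :=
    (contDiff_positionDeriv (l := 3) hV.contDiff (by norm_num)).differentiable (by norm_num)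
  have hpos := fun β => hasDerivAt_comp_alongJet_point hp (x, (acceleration L V x, j)) β
  have hvel := fun β => hasDerivAt_comp_alongJet_point hV.differentiable_velocityDeriv
    (x, (acceleration L V x, j)) β
  have hs : ∀ c : ℝ, HasDerivAt (fun s : ℝ => s * c) c 0 := fun c => by
    simpa using (hasDerivAt_id (0 : ℝ)).mul_const c
  have h1 := ((((hs (α * γ)).fun_smul (hpos (1 - γ))).fun_add
    ((hs ((1 - α) * (1 - γ))).fun_smul (hpos γ))).fun_sub
      ((hvel (1 - γ)).fun_const_smul α)).fun_sub ((hvel γ).fun_const_smul (1 - α))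
  refine h1.congr_deriv ?_
  -- The Euler-Lagrange equations replace `(∂p/∂v) a` by `∂L/∂y - (∂p/∂y) v`.
  have hsplit : ∀ β : ℝ, fderiv ℝ (velocityDeriv L) x (β • x.2, (1 / 2 : ℝ) • acceleration L V x)
      = β • fderiv ℝ (velocityDeriv L) x (x.2, 0)
        + (1 / 2 : ℝ) • (positionDeriv L x - fderiv ℝ (velocityDeriv L) x (x.2, 0)) := by
    intro β
    rw [← hV.arcDeriv_velocityDeriv, arcDeriv, ← map_sub, ← map_smul, ← map_smul, ← map_add]
    congr 1
    simp
  simp only [hsplit, zero_mul, zero_smul, zero_add, mul_zero, add_zero, ne_eq, OfNat.ofNat_ne_zero,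
    not_false_eq_true, zero_pow, zero_div]
  module

end LowOrder

/-! ### Endpoint derivatives of the low-order discrete Lagrangian. -/

section Slots

variable {n : ℕ} {L : Phase n × Phase n → ℝ} {V : Phase n × (Phase n →L[ℝ] ℝ) → Phase n}

theorem lowOrderDiscreteLagrangian_eq (L : Phase n × Phase n → ℝ) (α γ : ℝ) {h : ℝ} (h0 : h ≠ 0)
    (y₀ y₁ : Phase n) :
    lowOrderDiscreteLagrangian L α γ y₀ y₁ h
      = h * averagedLagrangian L α γ ((y₀, h⁻¹ • (y₁ - y₀)), h) := by
  have e : ∀ β : ℝ, y₀ + (β * h) • h⁻¹ • (y₁ - y₀) = (1 - β) • y₀ + β • y₁ := fun β => by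
    rw [smul_smul, mul_assoc, mul_inv_cancel₀ h0]
    module
  simp only [lowOrderDiscreteLagrangian, averagedLagrangian, e, sub_sub_cancel]
  ring

/-- Time reversal: read from `y₁` with step `-h`, the discrete velocity is unchanged and the two
evaluation points swap weights. The second derivative is thus minus the first one with `1 - α`, and
one expansion, for steps of either sign, covers both. -/
theorem hasFDerivAt_lowOrderDiscreteLagrangian (hL : Differentiable ℝ L) (α γ : ℝ) {h : ℝ}
    (h0 : h ≠ 0) (y₀ y₁ : Phase n) :
    HasFDerivAt (fun z : Phase n × Phase n => lowOrderDiscreteLagrangian L α γ z.1 z.2 h)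
      ((discreteMomentum L α γ ((y₀, h⁻¹ • (y₁ - y₀)), h)).comp
          (ContinuousLinearMap.fst ℝ (Phase n) (Phase n))
        + (-discreteMomentum L (1 - α) γ ((y₁, (-h)⁻¹ • (y₀ - y₁)), -h)).comp
          (ContinuousLinearMap.snd ℝ (Phase n) (Phase n))) (y₀, y₁) := by
  have e : ∀ β : ℝ, y₀ + (β * h) • h⁻¹ • (y₁ - y₀) = (1 - β) • y₀ + β • y₁ := fun β => by
    rw [smul_smul, mul_assoc, mul_inv_cancel₀ h0]
    module
  have e' : ∀ β : ℝ, y₁ + (β * -h) • (-h)⁻¹ • (y₀ - y₁) = β • y₀ + (1 - β) • y₁ := fun β => by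
    rw [smul_smul, mul_assoc, mul_inv_cancel₀ (neg_ne_zero.2 h0)]
    module
  have ep : (-h)⁻¹ • (y₀ - y₁) = h⁻¹ • (y₁ - y₀) := by
    rw [inv_neg]
    module
  let f := ContinuousLinearMap.fst ℝ (Phase n) (Phase n)
  let s := ContinuousLinearMap.snd ℝ (Phase n) (Phase n)
  have hterm : ∀ β : ℝ, HasFDerivAt (fun z : Phase n × Phase n =>
      L (β • z.1 + (1 - β) • z.2, h⁻¹ • (z.2 - z.1)))
      ((fderiv ℝ L (β • y₀ + (1 - β) • y₁, h⁻¹ • (y₁ - y₀))).comp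
        ((β • f + (1 - β) • s).prod (h⁻¹ • (s - f)))) (y₀, y₁) := fun β =>
    (hL (β • y₀ + (1 - β) • y₁, h⁻¹ • (y₁ - y₀))).hasFDerivAt.comp
      (f := fun z : Phase n × Phase n => (β • z.1 + (1 - β) • z.2, h⁻¹ • (z.2 - z.1))) (y₀, y₁)
      ((β • f + (1 - β) • s).prod (h⁻¹ • (s - f))).hasFDerivAt
  have h1 := ((hterm γ).const_mul (h * α)).add ((hterm (1 - γ)).const_mul (h * (1 - α)))
  simp only [sub_sub_cancel] at h1
  refine h1.congr_fderiv ?_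
  refine ContinuousLinearMap.ext fun w => ?_
  simp only [discreteMomentum, ep, e, mul_neg]
  simp only [← mul_neg, ← ep, e', sub_sub_cancel]
  simp only [ep, add_apply, smul_apply,
    ContinuousLinearMap.comp_apply, ContinuousLinearMap.prod_apply, sub_apply,
    neg_apply, fderiv_apply_eq_add, map_add, map_sub, map_smul, smul_eq_mul,
    f, s, ContinuousLinearMap.coe_fst', ContinuousLinearMap.coe_snd']
  field_simp
  ring

end Slots

/-! ### Partial derivatives of discrete Lagrangians and the optimality conditions -/

section Conditions

variable {n : ℕ} {L : Phase n × Phase n → ℝ} {V : Phase n × (Phase n →L[ℝ] ℝ) → Phase n}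

/-- `P₁` and `P₂` are the derivatives of `L_d(·, ·, h)` in the first and in the second endpoint. -/
def HasSlotDerivs (Ld : Phase n → Phase n → ℝ → ℝ) (h : ℝ) (y₀ y₁ : Phase n)
    (P₁ P₂ : Phase n →L[ℝ] ℝ) : Prop :=
  HasFDerivAt (fun z : Phase n × Phase n => Ld z.1 z.2 h)
    (P₁.comp (ContinuousLinearMap.fst ℝ (Phase n) (Phase n))
      + P₂.comp (ContinuousLinearMap.snd ℝ (Phase n) (Phase n))) (y₀, y₁)

/-- The gradient representing the restriction of a functional to `q`-directions. -/
noncomputable def rieszFst (P : Phase n →L[ℝ] ℝ) : Conf n :=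
  (InnerProductSpace.toDual ℝ (Conf n)).symm (P.comp (ContinuousLinearMap.inl ℝ (Conf n) (Conf n)))

/-- The gradient representing the restriction of a functional to `λ`-directions. -/
noncomputable def rieszSnd (P : Phase n →L[ℝ] ℝ) : Conf n :=
  (InnerProductSpace.toDual ℝ (Conf n)).symm (P.comp (ContinuousLinearMap.inr ℝ (Conf n) (Conf n)))

theorem norm_rieszFst_sub_le (P Q : Phase n →L[ℝ] ℝ) : ‖rieszFst P - rieszFst Q‖ ≤ ‖P - Q‖ := by
  rw [rieszFst, rieszFst, ← map_sub, LinearIsometryEquiv.norm_map, ← ContinuousLinearMap.sub_comp]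
  exact (ContinuousLinearMap.opNorm_comp_le _ _).trans
    (mul_le_of_le_one_right (norm_nonneg _) (ContinuousLinearMap.norm_inl_le_one ℝ _ _))

theorem norm_rieszSnd_sub_le (P Q : Phase n →L[ℝ] ℝ) : ‖rieszSnd P - rieszSnd Q‖ ≤ ‖P - Q‖ := by
  rw [rieszSnd, rieszSnd, ← map_sub, LinearIsometryEquiv.norm_map, ← ContinuousLinearMap.sub_comp]
  exact (ContinuousLinearMap.opNorm_comp_le _ _).trans
    (mul_le_of_le_one_right (norm_nonneg _) (ContinuousLinearMap.norm_inr_le_one ℝ _ _))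

theorem rieszSnd_neg (P : Phase n →L[ℝ] ℝ) : rieszSnd (-P) = -rieszSnd P := by
  rw [rieszSnd, rieszSnd, ContinuousLinearMap.neg_comp, map_neg]

theorem norm_rieszSnd_le (P : Phase n →L[ℝ] ℝ) : ‖rieszSnd P‖ ≤ ‖P‖ := by
  have := norm_rieszSnd_sub_le P 0
  simpa [rieszSnd] using this

theorem inner_rieszSnd (P : Phase n →L[ℝ] ℝ) (w : Conf n) : inner ℝ (rieszSnd P) w = P (0, w) := by
  simp [rieszSnd]

theorem gradient_prod_fst {φ : Phase n → ℝ} (q v : Conf n) (hφ : DifferentiableAt ℝ φ (q, v)) :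
    gradient (fun q => φ (q, v)) q = rieszFst (fderiv ℝ φ (q, v)) := by
  have H : HasFDerivAt (fun q => φ (q, v)) _ q :=
    hφ.hasFDerivAt.comp q (hasFDerivAt_prodMk_left q v)
  rw [gradient, H.fderiv]
  rfl

theorem gradient_prod_snd {φ : Phase n → ℝ} (q v : Conf n) (hφ : DifferentiableAt ℝ φ (q, v)) :
    gradient (fun v => φ (q, v)) v = rieszSnd (fderiv ℝ φ (q, v)) := by
  have H : HasFDerivAt (fun v => φ (q, v)) _ v :=
    hφ.hasFDerivAt.comp v (hasFDerivAt_prodMk_right q v)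
  rw [gradient, H.fderiv]
  rfl

namespace HasSlotDerivs

variable {Ld : Phase n → Phase n → ℝ → ℝ} {h : ℝ} {y₀ y₁ : Phase n} {P₁ P₂ : Phase n →L[ℝ] ℝ}

theorem hasFDerivAt_left (H : HasSlotDerivs Ld h y₀ y₁ P₁ P₂) :
    HasFDerivAt (fun y => Ld y y₁ h) P₁ y₀ :=
  (HasFDerivAt.comp (f := fun y => (y, y₁)) y₀ H (hasFDerivAt_prodMk_left y₀ y₁)).congr_fderiv
    (by ext1 <;> simp [ContinuousLinearMap.add_comp, ContinuousLinearMap.comp_assoc])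

theorem hasFDerivAt_right (H : HasSlotDerivs Ld h y₀ y₁ P₁ P₂) :
    HasFDerivAt (fun y => Ld y₀ y h) P₂ y₁ :=
  (HasFDerivAt.comp (f := fun y => (y₀, y)) y₁ H (hasFDerivAt_prodMk_right y₀ y₁)).congr_fderiv
    (by ext1 <;> simp [ContinuousLinearMap.add_comp, ContinuousLinearMap.comp_assoc])

theorem slotD1_eq (H : HasSlotDerivs Ld h y₀ y₁ P₁ P₂) : slotD1 Ld y₀ y₁ h = P₁ :=
  H.hasFDerivAt_left.fderiv

theorem slotD2_eq (H : HasSlotDerivs Ld h y₀ y₁ P₁ P₂) : slotD2 Ld y₀ y₁ h = P₂ :=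
  H.hasFDerivAt_right.fderiv

theorem velocityMinus_eq (H : HasSlotDerivs Ld h y₀ y₁ P₁ P₂) :
    velocityMinus Ld y₀ y₁ h = -rieszSnd P₁ := by
  have := gradient_prod_snd (φ := fun y => Ld y y₁ h) y₀.1 y₀.2 H.hasFDerivAt_left.differentiableAt
  rw [velocityMinus, this, H.hasFDerivAt_left.fderiv]

theorem velocityPlus_eq (H : HasSlotDerivs Ld h y₀ y₁ P₁ P₂) :
    velocityPlus Ld y₀ y₁ h = rieszSnd P₂ := by
  have := gradient_prod_snd (φ := fun y => Ld y₀ y h) y₁.1 y₁.2 H.hasFDerivAt_right.differentiableAt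
  rw [velocityPlus, this, H.hasFDerivAt_right.fderiv]

theorem gradient_fst_left (H : HasSlotDerivs Ld h y₀ y₁ P₁ P₂) :
    gradient (fun q => Ld (q, y₀.2) y₁ h) y₀.1 = rieszFst P₁ := by
  have := gradient_prod_fst (φ := fun y => Ld y y₁ h) y₀.1 y₀.2 H.hasFDerivAt_left.differentiableAt
  rw [this, H.hasFDerivAt_left.fderiv]

theorem gradient_fst_right (H : HasSlotDerivs Ld h y₀ y₁ P₁ P₂) :
    gradient (fun q => Ld y₀ (q, y₁.2) h) y₁.1 = rieszFst P₂ := by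
  have := gradient_prod_fst (φ := fun y => Ld y₀ y h) y₁.1 y₁.2 H.hasFDerivAt_right.differentiableAt
  rw [this, H.hasFDerivAt_right.fderiv]

end HasSlotDerivs

/-- The discrete optimality conditions are controlled by the slot derivatives. -/
theorem conditionsWithin_of_hasSlotDerivs {Ld Ld' : Phase n → Phase n → ℝ → ℝ}
    {φ : Conf n × Conf n → ℝ} (hφ : Differentiable ℝ φ) {yd : ℕ → Phase n} {h ε C : ℝ} {N : ℕ}
    {P₁ P₂ Q₁ Q₂ P₁' P₂' Q₁' Q₂' : Phase n →L[ℝ] ℝ} (qInit vInit μ ν : Conf n)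
    (hEL : ∀ k, 1 ≤ k → k + 1 ≤ N → ‖residualEL Ld yd h k - residualEL Ld' yd h k‖ ≤ ε)
    (H₀ : HasSlotDerivs Ld h (yd 0) (yd 1) P₁ Q₂) (H₀' : HasSlotDerivs Ld' h (yd 0) (yd 1) P₁' Q₂')
    (hN : HasSlotDerivs Ld h (yd (N - 1)) (yd N) Q₁ P₂)
    (hN' : HasSlotDerivs Ld' h (yd (N - 1)) (yd N) Q₁' P₂')
    (hP₁ : ‖P₁ - P₁'‖ ≤ ε) (hC : 0 ≤ C) (hP₂ : (C + 1) * ‖P₂ - P₂'‖ ≤ ε)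
    (hφC : ‖fderiv ℝ φ ((yd N).1, rieszSnd P₂) - fderiv ℝ φ ((yd N).1, rieszSnd P₂')‖
      ≤ C * ‖rieszSnd P₂ - rieszSnd P₂'‖) :
    ConditionsWithin Ld Ld' φ qInit vInit yd μ ν h N ε := by
  have hε : 0 ≤ ε := (norm_nonneg _).trans hP₁
  have hφC' : ‖fderiv ℝ φ ((yd N).1, rieszSnd P₂) - fderiv ℝ φ ((yd N).1, rieszSnd P₂')‖
      ≤ C * ‖P₂ - P₂'‖ := hφC.trans (by gcongr; exact norm_rieszSnd_sub_le _ _)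
  have hP0 := norm_nonneg (P₂ - P₂')
  refine ⟨hEL, ?_, ?_, ?_, ?_, ?_, ?_⟩
  · rw [residualQ0, residualQ0, H₀.gradient_fst_left, H₀'.gradient_fst_left, sub_sub_sub_cancel_left,
      norm_sub_rev]
    exact (norm_rieszFst_sub_le _ _).trans hP₁
  · rw [residualQN, residualQN, hN.gradient_fst_right, hN'.gradient_fst_right, hN.velocityPlus_eq,
      hN'.velocityPlus_eq, gradient_prod_fst _ _ (hφ _), gradient_prod_fst _ _ (hφ _),
      sub_sub_sub_comm]
    refine ((norm_sub_le _ _).trans (add_le_add ((norm_rieszFst_sub_le _ _).trans hφC')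
      (norm_rieszFst_sub_le P₂ P₂'))).trans ?_
    linarith
  · simpa [residualMu] using hε
  · rw [residualNu, residualNu, H₀.velocityMinus_eq, H₀'.velocityMinus_eq, sub_sub_sub_cancel_right,
      neg_sub_neg, norm_sub_rev]
    exact (norm_rieszSnd_sub_le _ _).trans hP₁
  · simpa [residualV0] using hε
  · rw [residualVN, residualVN, hN.velocityPlus_eq, hN'.velocityPlus_eq,
      gradient_prod_snd _ _ (hφ _), gradient_prod_snd _ _ (hφ _), add_sub_add_left_eq_sub]
    refine ((norm_rieszSnd_sub_le _ _).trans hφC').trans ?_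
    linarith

/-- Serves the terminal conditions, where the two discrete Lagrangians enter the derivative of `φ`
only through `v_N⁺`. -/
theorem ContDiff.exists_fderiv_lipschitz_snd {φ : Phase n → ℝ} (hφ : ContDiff ℝ 2 φ) (R M : ℝ) :
    ∃ B : ℝ, 0 ≤ B ∧ ∀ q w w' : Conf n, ‖q‖ ≤ R → ‖w‖ ≤ M → ‖w'‖ ≤ M →
      ‖fderiv ℝ φ (q, w) - fderiv ℝ φ (q, w')‖ ≤ B * ‖w - w'‖ := by
  obtain ⟨B, hB0, hB⟩ := (hφ.fderiv_right (m := 1) (by norm_num)).exists_lipschitz_of_isBounded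
    one_ne_zero (Metric.isBounded_closedBall (x := (0 : Phase n)) (r := max R M))
  have hball : ∀ q w : Conf n, ‖q‖ ≤ R → ‖w‖ ≤ M →
      (q, w) ∈ Metric.closedBall (0 : Phase n) (max R M) := fun q w hq hw =>
    mem_closedBall_zero_iff.2 (max_le_max hq hw)
  refine ⟨B, hB0, fun q w w' hq hw hw' => (hB _ (hball q w hq hw) _ (hball q w' hq hw')).trans_eq ?_⟩
  simp [Prod.norm_def]

/-- The equation is autonomous, so each grid interval can be shifted to start at `0`. Contributions
of adjacent intervals are opposite momenta at the common grid point. -/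
theorem HasInverseLegendre.exists_hasSlotDerivs_exact (hV : HasInverseLegendre L V)
    {W : Set (Phase n × Phase n)} (hWo : IsOpen W) (hWb : Bornology.IsBounded W) :
    ∃ h₀ > 0, h₀ ≤ 1 ∧ ∀ (T h : ℝ), 0 < h → h ≤ h₀ → ∀ y v : ℝ → Phase n,
      IsSecondOrderArc (acceleration L V) 0 T y v → (∀ t ∈ Icc 0 T, (y t, v t) ∈ W) →
      ∀ a, 0 ≤ a → a + h ≤ T →
        HasSlotDerivs (exactDiscreteLagrangian L W) h (y a) (y (a + h))
          (-velocityDeriv L (y a, v a)) (velocityDeriv L (y (a + h), v (a + h))) := by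
  obtain ⟨h₀, hh₀, hh1, H⟩ := hV.exists_exactDiscreteLagrangian hWo hWb
  refine ⟨h₀, hh₀, hh1, fun T h h0 hh y v hx hxW a ha hT => ?_⟩
  obtain ⟨-, -, h3⟩ := H h h0 hh _ _ (hx.shift ha hT) fun t ht =>
    hxW (a + t) ⟨by linarith [ht.1], by linarith [ht.2]⟩
  simp only [add_zero] at h3
  refine h3.congr_fderiv ?_
  rw [ContinuousLinearMap.neg_comp, neg_add_eq_sub]

theorem hasSlotDerivs_lowOrder (hL : Differentiable ℝ L) (α γ : ℝ) {h : ℝ} (h0 : h ≠ 0)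
    (y : ℝ → Phase n) (a : ℝ) :
    HasSlotDerivs (lowOrderDiscreteLagrangian L α γ) h (y a) (y (a + h))
      (discreteMomentum L α γ ((y a, h⁻¹ • (y (a + h) - y a)), h))
      (-discreteMomentum L (1 - α) γ
        ((y (a + h), (-h)⁻¹ • (y (a + h + -h) - y (a + h))), -h)) := by
  rw [add_neg_cancel_right]
  exact hasFDerivAt_lowOrderDiscreteLagrangian hL α γ h0 (y a) (y (a + h))

end Conditions

/-! ### Consistency orders -/

section Orders

variable {n : ℕ} {L : Phase n × Phase n → ℝ} {V : Phase n × (Phase n →L[ℝ] ℝ) → Phase n}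

/-- The leading error coefficient. -/
noncomputable def errorCoeff (α γ : ℝ) : ℝ := (1 - 2 * α) * (1 - 2 * γ) / 2

theorem errorCoeff_eq_zero_iff {α γ : ℝ} : errorCoeff α γ = 0 ↔ α = 1 / 2 ∨ γ = 1 / 2 := by
  simp only [errorCoeff, div_eq_zero_iff, mul_eq_zero, OfNat.ofNat_ne_zero, or_false]
  constructor <;> rintro (h | h) <;> [left; right; left; right] <;> linarith

theorem errorCoeff_one_sub (α γ : ℝ) : errorCoeff (1 - α) γ = -errorCoeff α γ := by
  simp only [errorCoeff]
  ring

/-- The leading error of the momentum. -/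
noncomputable def momentumDefect (L : Phase n × Phase n → ℝ) (x : Phase n × Phase n) :
    Phase n →L[ℝ] ℝ :=
  positionDeriv L x + fderiv ℝ (velocityDeriv L) x (x.2, 0)

theorem HasInverseLegendre.exists_discreteMomentum_taylor (hV : HasInverseLegendre L V) (α γ : ℝ)
    {S : Set (Phase n × Phase n)} (hS : Bornology.IsBounded S) :
    ∃ C : ℝ, 0 ≤ C ∧ ∀ (a b : ℝ) (y v : ℝ → Phase n),
      IsSecondOrderArc (acceleration L V) a b y v → (∀ t ∈ Icc a b, (y t, v t) ∈ S) →
      ∀ t ∈ Icc a b, ∀ s, t + s ∈ Icc a b → s ≠ 0 → |s| ≤ 1 →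
        ‖discreteMomentum L α γ ((y t, s⁻¹ • (y (t + s) - y t)), s) + velocityDeriv L (y t, v t)
          - (s * errorCoeff α γ) • momentumDefect L (y t, v t)‖ ≤ C * |s| ^ 2 := by
  obtain ⟨C, hC0, hC⟩ := exists_discrete_taylor_one hV.contDiff_acceleration
    (contDiff_discreteMomentum (l := 2) hV.contDiff (by norm_num) α γ) hS
  refine ⟨C, hC0, fun a b y v hx hxS t ht s hts hs0 hs1 => ?_⟩
  have := hC a b y v hx hxS t ht s hts hs0 hs1
  rwa [discreteMomentum_zero, sub_neg_eq_add, solutionJet, timeDeriv_discreteMomentum hV,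
    smul_smul] at this

/-- The error of the boundary momenta. -/
theorem HasInverseLegendre.exists_norm_discreteMomentum_add_le (hV : HasInverseLegendre L V)
    (α γ : ℝ) {r : ℕ} (hr : r = 1 ∨ r = 2 ∧ errorCoeff α γ = 0)
    {S : Set (Phase n × Phase n)} (hS : Bornology.IsBounded S) :
    ∃ C : ℝ, 0 ≤ C ∧ ∀ (a b : ℝ) (y v : ℝ → Phase n),
      IsSecondOrderArc (acceleration L V) a b y v → (∀ t ∈ Icc a b, (y t, v t) ∈ S) →
      ∀ t ∈ Icc a b, ∀ s, t + s ∈ Icc a b → s ≠ 0 → |s| ≤ 1 →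
        ‖discreteMomentum L α γ ((y t, s⁻¹ • (y (t + s) - y t)), s) + velocityDeriv L (y t, v t)‖
          ≤ C * |s| ^ r := by
  obtain ⟨C, hC0, hC⟩ := hV.exists_discreteMomentum_taylor α γ hS
  rcases hr with rfl | ⟨rfl, hκ⟩
  · have hc : Continuous (momentumDefect L) :=
      (contDiff_positionDeriv (l := 0) hV.contDiff (by norm_num)).continuous.add
        (contDiff_arcDeriv (F := fun _ => (0 : Phase n)) (l := 0) contDiff_const
          (contDiff_velocityDeriv (l := 1) hV.contDiff (by norm_num)) (by norm_num)).continuous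
    obtain ⟨M, hM0, hM⟩ := hc.exists_norm_le_of_isBounded hS
    refine ⟨C + |errorCoeff α γ| * M, by positivity, fun a b y v hx hxS t ht s hts hs0 hs1 => ?_⟩
    have h1 := hC a b y v hx hxS t ht s hts hs0 hs1
    have h2 := hM _ (hxS t ht)
    have h3 := norm_add_le (discreteMomentum L α γ ((y t, s⁻¹ • (y (t + s) - y t)), s)
      + velocityDeriv L (y t, v t) - (s * errorCoeff α γ) • momentumDefect L (y t, v t))
      ((s * errorCoeff α γ) • momentumDefect L (y t, v t))
    rw [sub_add_cancel, norm_smul, Real.norm_eq_abs, abs_mul] at h3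
    have h4 : C * |s| ^ 2 ≤ C * |s| := by
      gcongr
      exact pow_le_of_le_one (abs_nonneg s) hs1 (by norm_num)
    have h5 : |s| * |errorCoeff α γ| * ‖momentumDefect L (y t, v t)‖
      ≤ |s| * |errorCoeff α γ| * M := by gcongr
    rw [pow_one]
    linarith
  · refine ⟨C, hC0, fun a b y v hx hxS t ht s hts hs0 hs1 => ?_⟩
    have h1 := hC a b y v hx hxS t ht s hts hs0 hs1
    rwa [hκ, mul_zero, zero_smul, sub_zero] at h1

/-- The residual of the discrete Euler-Lagrange equations along a solution. -/
theorem HasInverseLegendre.exists_norm_discreteMomentum_sub_le (hV : HasInverseLegendre L V)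
    (α γ : ℝ) {r : ℕ} (hr : r = 1 ∨ r = 2 ∧ errorCoeff α γ = 0)
    {S : Set (Phase n × Phase n)} (hS : Bornology.IsBounded S) :
    ∃ C : ℝ, 0 ≤ C ∧ ∀ (a b : ℝ) (y v : ℝ → Phase n),
      IsSecondOrderArc (acceleration L V) a b y v → (∀ t ∈ Icc a b, (y t, v t) ∈ S) →
      ∀ t ∈ Icc a b, ∀ s, t + s ∈ Icc a b → t + -s ∈ Icc a b → s ≠ 0 → |s| ≤ 1 →
        ‖discreteMomentum L α γ ((y t, s⁻¹ • (y (t + s) - y t)), s)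
          - discreteMomentum L (1 - α) γ ((y t, (-s)⁻¹ • (y (t + -s) - y t)), -s)‖
          ≤ C * |s| ^ (r + 1) := by
  rcases hr with rfl | ⟨rfl, hκ⟩
  · obtain ⟨C, hC0, hC⟩ := hV.exists_discreteMomentum_taylor α γ hS
    obtain ⟨D, hD0, hD⟩ := hV.exists_discreteMomentum_taylor (1 - α) γ hS
    refine ⟨C + D, by positivity, fun a b y v hx hxS t ht s hts hts' hs0 hs1 => ?_⟩
    have h1 := hC a b y v hx hxS t ht s hts hs0 hs1
    have h2 := hD a b y v hx hxS t ht (-s) hts' (neg_ne_zero.2 hs0) (by rwa [abs_neg])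
    -- Both the step and the error coefficient change sign, so the linear terms of the two
    -- expansions coincide and cancel in the difference.
    rw [abs_neg, errorCoeff_one_sub, neg_mul_neg] at h2
    rw [add_mul]
    refine le_trans (le_of_eq ?_) ((norm_sub_le _ _).trans (add_le_add h1 h2))
    congr 1
    abel
  · rw [discreteMomentum_one_sub L (errorCoeff_eq_zero_iff.1 hκ)]
    obtain ⟨C, hC0, hC⟩ := exists_discrete_taylor_odd hV.contDiff_acceleration
      (contDiff_discreteMomentum (l := 3) hV.contDiff (by norm_num) α γ) hS
    refine ⟨C, hC0, fun a b y v hx hxS t ht s hts hts' hs0 hs1 => ?_⟩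
    have := hC a b y v hx hxS t ht s hts hts' hs0 hs1
    rwa [solutionJet, timeDeriv_discreteMomentum hV, ← errorCoeff, hκ, zero_smul, smul_zero,
      sub_zero] at this

/-- Expansion of the error of the low-order discrete Lagrangian. -/
theorem HasInverseLegendre.exists_lowOrder_error (hV : HasInverseLegendre L V) (α γ : ℝ)
    {S : Set (Phase n × Phase n)} (hS : Bornology.IsBounded S) :
    ∃ C : ℝ, 0 ≤ C ∧ ∀ h, 0 < h → h ≤ 1 → ∀ y v : ℝ → Phase n,
      IsSecondOrderArc (acceleration L V) 0 h y v → (∀ t ∈ Icc 0 h, (y t, v t) ∈ S) →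
        |lowOrderDiscreteLagrangian L α γ (y 0) (y h) h - (∫ t in (0 : ℝ)..h, L (y t, v t))
          + h ^ 2 * (errorCoeff α γ * positionDeriv L (y 0, v 0) (v 0))| ≤ C * h ^ 3 := by
  obtain ⟨C, hC0, hC⟩ := exists_discrete_taylor_one hV.contDiff_acceleration
    (contDiff_averagedLagrangian (hV.contDiff.of_le (by norm_num)) α γ) hS
  obtain ⟨D, hD0, hD⟩ := exists_arc_taylor_one (hV.contDiff_acceleration.of_le (by norm_num))
    (hV.contDiff.of_le (by norm_num)) hS
  refine ⟨C + D, by positivity, fun h h0 h1 y v hx hxS => ?_⟩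
  have hm0 : (0 : ℝ) ∈ Icc 0 h := ⟨le_rfl, h0.le⟩
  have hmh : h ∈ Icc 0 h := ⟨h0.le, le_rfl⟩
  have hLow := hC 0 h y v hx hxS 0 hm0 h (by rwa [zero_add]) h0.ne' (by rwa [abs_of_pos h0])
  rw [averagedLagrangian_zero, solutionJet, timeDeriv_averagedLagrangian hV, ← errorCoeff,
    zero_add, Real.norm_eq_abs, smul_eq_mul, abs_of_pos h0] at hLow
  set x := (y 0, v 0) with hx0
  set d := arcDeriv (acceleration L V) L x
  have hint : |(∫ t in (0 : ℝ)..h, L (y t, v t)) - (h * L x + h ^ 2 / 2 * d)| ≤ D * h ^ 3 := by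
    have hi : IntervalIntegrable (fun t => L (y t, v t)) MeasureTheory.volume 0 h := by
      refine ContinuousOn.intervalIntegrable ?_
      rw [uIcc_of_le h0.le]
      exact hV.contDiff.continuous.comp_continuousOn hx.continuousOn
    have hi' : IntervalIntegrable (fun t => L x + t * d) MeasureTheory.volume 0 h :=
      Continuous.intervalIntegrable (by fun_prop) _ _
    have e : (∫ t in (0 : ℝ)..h, (L x + t * d)) = h * L x + h ^ 2 / 2 * d := by
      rw [intervalIntegral.integral_add (Continuous.intervalIntegrable (by fun_prop) _ _)
        (Continuous.intervalIntegrable (by fun_prop) _ _), intervalIntegral.integral_mul_const,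
        integral_id]
      simp
    rw [← e, ← intervalIntegral.integral_sub hi hi']
    have := intervalIntegral.norm_integral_le_of_norm_le_const (a := 0) (b := h) (C := D * h ^ 2)
      (f := fun t => L (y t, v t) - (L x + t * d)) (fun t ht => ?_)
    · rw [sub_zero, abs_of_pos h0] at this
      exact this.trans_eq (by ring)
    · rw [uIoc_of_le h0.le] at ht
      have := hD 0 h y v hx hxS 0 hm0 t (Ioc_subset_Icc_self ht)
      rw [sub_zero, smul_eq_mul, abs_of_pos ht.1, sub_sub] at this
      refine this.trans ?_
      gcongr
      · exact ht.1.le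
      · exact ht.2
  rw [lowOrderDiscreteLagrangian_eq L α γ h0.ne']
  set m := averagedLagrangian L α γ ((y 0, h⁻¹ • (y h - y 0)), h)
  have hm := mul_le_mul_of_nonneg_left hLow h0.le
  rw [← abs_of_pos h0, ← abs_mul, abs_of_pos h0] at hm
  calc _ = |h * (m - L x - h * (1 / 2 * d - errorCoeff α γ * positionDeriv L x x.2))
        - ((∫ t in (0 : ℝ)..h, L (y t, v t)) - (h * L x + h ^ 2 / 2 * d))| := by
          congr 1
          simp only [hx0]
          ring
    _ ≤ h * (C * h ^ 2) + D * h ^ 3 := (abs_sub _ _).trans (add_le_add hm hint)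
    _ = _ := by ring

theorem HasInverseLegendre.lagrangianHasOrder (hV : HasInverseLegendre L V) (α γ : ℝ) {r : ℕ}
    (hr : r = 1 ∨ r = 2 ∧ errorCoeff α γ = 0) :
    LagrangianHasOrder L (lowOrderDiscreteLagrangian L α γ) r := by
  intro W K hWo hWb hK hKW
  obtain ⟨h₀, hh₀, hh1, H⟩ := hV.exists_exactDiscreteLagrangian hWo hWb
  obtain ⟨C, hC0, hC⟩ := hV.exists_lowOrder_error α γ hK.isBounded
  have hc : Continuous fun x : Phase n × Phase n => positionDeriv L x x.2 :=
    (contDiff_positionDeriv (l := 0) hV.contDiff (by norm_num)).continuous.clm_apply continuous_snd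
  obtain ⟨M, hM0, hM⟩ := hc.exists_norm_le_of_isBounded hK.isBounded
  refine ⟨C + |errorCoeff α γ| * M, h₀, hh₀, fun h h0 hh y v hx hxK => ?_⟩
  rw [hV.isEulerLagrangeArc_iff] at hx
  rw [(H h h0 hh y v hx fun t ht => hKW (hxK t ht)).2.1]
  have h1 := hC h h0 (hh.trans hh1) y v hx hxK
  rcases hr with rfl | ⟨rfl, hκ⟩
  · have h2 := hM _ (hxK 0 ⟨le_rfl, h0.le⟩)
    have h3 := abs_sub (lowOrderDiscreteLagrangian L α γ (y 0) (y h) h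
      - (∫ t in (0 : ℝ)..h, L (y t, v t))
      + h ^ 2 * (errorCoeff α γ * positionDeriv L (y 0, v 0) (v 0)))
      (h ^ 2 * (errorCoeff α γ * positionDeriv L (y 0, v 0) (v 0)))
    rw [add_sub_cancel_right, abs_mul (h ^ 2), abs_mul (errorCoeff α γ),
      abs_of_pos (by positivity : 0 < h ^ 2)] at h3
    have h4 : C * h ^ 3 ≤ C * h ^ 2 := by
      gcongr C * ?_
      exact pow_le_pow_of_le_one h0.le (hh.trans hh1) (by norm_num)
    have h5 : h ^ 2 * (|errorCoeff α γ| * |positionDeriv L (y 0, v 0) (v 0)|)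
      ≤ h ^ 2 * (|errorCoeff α γ| * M) := by gcongr; exact h2
    norm_num
    linarith
  · rw [hκ, zero_mul, mul_zero, add_zero] at h1
    simpa [hκ] using h1

theorem HasInverseLegendre.conditionsHaveOrder (hV : HasInverseLegendre L V)
    {φ : Conf n × Conf n → ℝ} (hφ : ContDiff ℝ 2 φ) (α γ : ℝ) {r : ℕ}
    (hr : r = 1 ∨ r = 2 ∧ errorCoeff α γ = 0) :
    ConditionsHaveOrder L φ (lowOrderDiscreteLagrangian L α γ) r := by
  intro W K hWo hWb hK hKW
  have hKb := hK.isBounded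
  obtain ⟨h₀, hh₀, hh1, H⟩ := hV.exists_hasSlotDerivs_exact hWo hWb
  obtain ⟨C₁, hC₁0, hC₁⟩ := hV.exists_norm_discreteMomentum_add_le α γ hr hKb
  obtain ⟨C₂, hC₂0, hC₂⟩ := hV.exists_norm_discreteMomentum_add_le (1 - α) γ
    (hr.imp_right (And.imp_right fun h => by rw [errorCoeff_one_sub, h, neg_zero])) hKb
  obtain ⟨C₃, hC₃0, hC₃⟩ := hV.exists_norm_discreteMomentum_sub_le α γ hr hKb
  obtain ⟨M, hM0, hM⟩ := ((contDiff_velocityDeriv (l := 0) hV.contDiff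
    (by norm_num)).continuous.exists_norm_le_of_isBounded hKb)
  obtain ⟨R, hR0, hR⟩ := (continuous_fst (X := Phase n) (Y := Phase n)).exists_norm_le_of_isBounded
    hKb
  -- The exact momentum is bounded by `M` and, since `h ≤ 1`, the discrete one by `M + C₂`; both
  -- values of `v_N⁺` lie in this range.
  obtain ⟨B, hB0, hB⟩ := hφ.exists_fderiv_lipschitz_snd R (M + C₂)
  refine ⟨C₁ + (B + 1) * C₂ + C₃, h₀, hh₀, ?_⟩
  intro T N hT hN hh y v hx hxK qInit vInit μ ν
  rw [hV.isEulerLagrangeArc_iff] at hx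
  have hN0 : (0 : ℝ) < N := by exact_mod_cast hN
  set h := T / N with hhdef
  have h0 : 0 < h := div_pos hT hN0
  have hNh : N * h = T := by rw [hhdef]; field_simp
  have hle1 : h ≤ 1 := hh.trans hh1
  have hmem : ∀ k : ℕ, k ≤ N → (k : ℝ) * h ∈ Icc 0 T := fun k hk =>
    ⟨by positivity, by rw [← hNh]; gcongr⟩
  have hsucc : ∀ k : ℕ, ((k + 1 : ℕ) : ℝ) * h = k * h + h := fun k => by push_cast; ring
  have habs : |h| = h := abs_of_pos h0
  have hexact : ∀ k : ℕ, k + 1 ≤ N → HasSlotDerivs (exactDiscreteLagrangian L W) h (y (k * h))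
      (y (k * h + h)) (-velocityDeriv L (y (k * h), v (k * h)))
      (velocityDeriv L (y (k * h + h), v (k * h + h))) := fun k hk =>
    (H T h h0 hh y v hx (fun t ht => hKW (hxK t ht)) (k * h) (by positivity)
      (by rw [← hsucc]; exact (hmem _ hk).2))
  have hlow := fun k : ℕ => hasSlotDerivs_lowOrder hV.differentiable α γ h0.ne' y (k * h)
  simp only [← hsucc] at hexact hlow
  obtain ⟨m, rfl⟩ : ∃ m, N = m + 1 := ⟨N - 1, by omega⟩
  have hback : ∀ k : ℕ, ((k + 1 : ℕ) : ℝ) * h + -h = k * h := fun k => by rw [hsucc]; ring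
  have hP₂ : ‖-discreteMomentum L (1 - α) γ
      ((y ((m + 1 : ℕ) * h), (-h)⁻¹ • (y ((m + 1 : ℕ) * h + -h) - y ((m + 1 : ℕ) * h))), -h)
      - velocityDeriv L (y ((m + 1 : ℕ) * h), v ((m + 1 : ℕ) * h))‖ ≤ C₂ * h ^ r := by
    have := hC₂ 0 T y v hx hxK _ (hmem _ le_rfl) (-h)
      (by rw [hback]; exact hmem m (by omega)) (neg_ne_zero.2 h0.ne') (by rwa [abs_neg, habs])
    rw [abs_neg, habs] at this
    rwa [← neg_add', norm_neg]
  refine conditionsWithin_of_hasSlotDerivs (hφ.differentiable (by norm_num)) (C := B) qInit vInit μ ν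
    ?_ (hlow 0) (hexact 0 (by omega)) (hlow m) (hexact m le_rfl) ?_ hB0 ?_ ?_
  · intro k hk1 hkN
    obtain ⟨j, rfl⟩ : ∃ j, k = j + 1 := ⟨k - 1, by omega⟩
    have e1 := hlow j
    have e2 := hlow (j + 1)
    have e3 := hexact j (by omega)
    have e4 := hexact (j + 1) hkN
    simp only [residualEL, add_tsub_cancel_right]
    -- The exact residual is `p - p = 0`. The low-order one is of size `h ^ (r + 1)`, which pays for
    -- the factor `1 / h`.
    rw [e1.slotD2_eq, e2.slotD1_eq, e3.slotD2_eq, e4.slotD1_eq, add_neg_cancel, smul_zero,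
      sub_zero, norm_smul, norm_inv, Real.norm_eq_abs, habs, inv_mul_le_iff₀ h0, neg_add_eq_sub,
      hsucc (j + 1)]
    have := hC₃ 0 T y v hx hxK _ (hmem (j + 1) (by omega)) h (by rw [← hsucc]; exact hmem _ hkN)
      (by rw [hback]; exact hmem j (by omega)) h0.ne' (by rwa [habs])
    rw [habs] at this
    refine this.trans ?_
    rw [pow_succ]
    have : 0 ≤ (C₁ + (B + 1) * C₂) * (h ^ r * h) := by positivity
    nlinarith
  · have := hC₁ 0 T y v hx hxK _ (hmem 0 (by omega)) h
      (by rw [← hsucc]; exact hmem 1 (by omega)) h0.ne' (by rwa [habs])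
    rw [habs, ← hsucc] at this
    rw [sub_neg_eq_add]
    refine this.trans ?_
    have : 0 ≤ ((B + 1) * C₂ + C₃) * h ^ r := by positivity
    linarith
  · refine (mul_le_mul_of_nonneg_left hP₂ (by positivity)).trans ?_
    have : 0 ≤ (C₁ + C₃) * h ^ r := by positivity
    linarith
  · have hP' := hM _ (hxK _ (hmem (m + 1) le_rfl))
    have hPP := hP₂.trans (mul_le_of_le_one_right hC₂0 (pow_le_one₀ h0.le hle1))
    have hRy := hR _ (hxK _ (hmem (m + 1) le_rfl))
    have hq : ‖(y ((m + 1 : ℕ) * h)).1‖ ≤ R := (norm_fst_le _).trans hRy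
    refine hB _ _ _ hq ?_ ?_
    · exact (norm_rieszSnd_le _).trans
        ((norm_le_norm_add_norm_sub' _ _).trans (add_le_add hP' hPP))
    · exact (norm_rieszSnd_le _).trans (hP'.trans (by linarith))

/-! ### Sharpness -/

theorem not_forall_le_mul_of_pos {c D h₁ : ℝ} (hc : 0 < c) (hh₁ : 0 < h₁)
    (H : ∀ h, 0 < h → h ≤ h₁ → c ≤ D * h) : False := by
  have hpos : 0 < c / (2 * (|D| + 1)) := by positivity
  have h1 := H (min h₁ (c / (2 * (|D| + 1)))) (lt_min hh₁ hpos) (min_le_left _ _)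
  have h2 : D * min h₁ (c / (2 * (|D| + 1))) ≤ (|D| + 1) * (c / (2 * (|D| + 1))) := by
    have : D ≤ |D| + 1 := (le_abs_self D).trans (by linarith)
    have hm : 0 < min h₁ (c / (2 * (|D| + 1))) := lt_min hh₁ hpos
    gcongr
    exact min_le_right _ _
  have h3 : (|D| + 1) * (c / (2 * (|D| + 1))) = c / 2 := by field_simp
  linarith

theorem IsSecondOrderArc.mono {E : Type*} [NormedAddCommGroup E] [NormedSpace ℝ E]
    {F : E × E → E} {a b a' b' : ℝ} {y v : ℝ → E} (hx : IsSecondOrderArc F a b y v)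
    (hsub : Icc a' b' ⊆ Icc a b) : IsSecondOrderArc F a' b' y v :=
  fun t ht => ⟨(hx t (hsub ht)).1.mono hsub, (hx t (hsub ht)).2.mono hsub⟩

/-- Along the solution starting at `x`, order two together with the error expansion would bound `h²
|κ (∂L/∂y) v|` by a multiple of `h³` for all small `h`. -/
theorem HasInverseLegendre.not_lagrangianHasOrder_two (hV : HasInverseLegendre L V) {α γ : ℝ}
    (hκ : errorCoeff α γ ≠ 0) {x : Phase n × Phase n} (hx : positionDeriv L x x.2 ≠ 0) :
    ¬ LagrangianHasOrder L (lowOrderDiscreteLagrangian L α γ) 2 := by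
  intro hord
  obtain ⟨C, h₁, hh₁, hC⟩ := hord (Metric.ball x 2) (Metric.closedBall x 1) Metric.isOpen_ball
    Metric.isBounded_ball (isCompact_closedBall x 1) (Metric.closedBall_subset_ball (by norm_num))
  obtain ⟨h₂, hh₂, hh₂1, H⟩ := hV.exists_exactDiscreteLagrangian (Metric.isOpen_ball (x := x) (ε := 2))
    Metric.isBounded_ball
  obtain ⟨D, hD0, hD⟩ := hV.exists_lowOrder_error α γ
    (Metric.isBounded_closedBall (x := x) (r := 1))
  obtain ⟨ε, hε, y, v, hy0, hv0, harc, hxK⟩ := exists_isSecondOrderArc_initial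
    (hV.contDiff_acceleration.of_le (by norm_num)) x (Metric.closedBall_mem_nhds x one_pos)
  refine not_forall_le_mul_of_pos (c := |errorCoeff α γ * positionDeriv L x x.2|) (D := C + D)
    (h₁ := min (min h₁ h₂) ε) (abs_pos.2 (mul_ne_zero hκ hx)) (by positivity) fun h h0 hh => ?_
  have hl1 : h ≤ h₁ := hh.trans ((min_le_left _ _).trans (min_le_left _ _))
  have hl2 : h ≤ h₂ := hh.trans ((min_le_left _ _).trans (min_le_right _ _))
  have hsub : Icc 0 h ⊆ Icc 0 ε := Icc_subset_Icc_right (hh.trans (min_le_right _ _))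
  have harc' := harc.mono hsub
  have hK' : ∀ t ∈ Icc 0 h, (y t, v t) ∈ Metric.closedBall x 1 := fun t ht => hxK t (hsub ht)
  have e1 := hC h h0 hl1 y v (hV.isEulerLagrangeArc_iff.2 harc') hK'
  rw [(H h h0 hl2 y v harc' fun t ht =>
    Metric.closedBall_subset_ball (by norm_num) (hK' t ht)).2.1] at e1
  have e2 := hD h h0 (hl2.trans hh₂1) y v harc' hK'
  rw [hy0, hv0] at e2
  rw [hy0] at e1
  have e3 := (abs_sub _ _).trans (add_le_add e2 e1)
  rw [add_sub_cancel_left, abs_mul, abs_of_pos (by positivity : 0 < h ^ 2)] at e3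
  have h2 : 0 < h ^ 2 := by positivity
  refine le_of_mul_le_mul_left (e3.trans_eq ?_) h2
  ring

/-- A single step (`N = 1`) and the condition `v₀⁻ = v⁰` already violate order two. This condition
sees the `λ`-part of the momentum error, whence the hypothesis on `rieszSnd`. -/
theorem HasInverseLegendre.not_conditionsHaveOrder_two (hV : HasInverseLegendre L V)
    (φ : Conf n × Conf n → ℝ) {α γ : ℝ} (hκ : errorCoeff α γ ≠ 0) {x : Phase n × Phase n}
    (hx : rieszSnd (momentumDefect L x) ≠ 0) :
    ¬ ConditionsHaveOrder L φ (lowOrderDiscreteLagrangian L α γ) 2 := by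
  intro hord
  obtain ⟨C, h₁, hh₁, hC⟩ := hord (Metric.ball x 2) (Metric.closedBall x 1) Metric.isOpen_ball
    Metric.isBounded_ball (isCompact_closedBall x 1) (Metric.closedBall_subset_ball (by norm_num))
  obtain ⟨h₂, hh₂, hh₂1, H⟩ := hV.exists_hasSlotDerivs_exact (Metric.isOpen_ball (x := x) (ε := 2))
    Metric.isBounded_ball
  obtain ⟨D, hD0, hD⟩ := hV.exists_discreteMomentum_taylor α γ
    (Metric.isBounded_closedBall (x := x) (r := 1))
  obtain ⟨ε, hε, y, v, hy0, hv0, harc, hxK⟩ := exists_isSecondOrderArc_initial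
    (hV.contDiff_acceleration.of_le (by norm_num)) x (Metric.closedBall_mem_nhds x one_pos)
  refine not_forall_le_mul_of_pos (c := |errorCoeff α γ| * ‖rieszSnd (momentumDefect L x)‖)
    (D := C + D) (h₁ := min (min h₁ h₂) ε)
    (mul_pos (abs_pos.2 hκ) (norm_pos_iff.2 hx)) (by positivity) fun h h0 hh => ?_
  have hl1 : h ≤ h₁ := hh.trans ((min_le_left _ _).trans (min_le_left _ _))
  have hl2 : h ≤ h₂ := hh.trans ((min_le_left _ _).trans (min_le_right _ _))
  have hsub : Icc 0 h ⊆ Icc 0 ε := Icc_subset_Icc_right (hh.trans (min_le_right _ _))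
  have harc' := harc.mono hsub
  have hK' : ∀ t ∈ Icc 0 h, (y t, v t) ∈ Metric.closedBall x 1 := fun t ht => hxK t (hsub ht)
  have e1 := (hC h 1 h0 le_rfl (by simpa using hl1) y v (hV.isEulerLagrangeArc_iff.2 harc') hK'
    0 0 0 0).varNu
  have s1 := hasSlotDerivs_lowOrder hV.differentiable α γ h0.ne' y 0
  have s2 := (H h h h0 hl2 y v harc' (fun t ht =>
    Metric.closedBall_subset_ball (by norm_num) (hK' t ht)) 0 le_rfl (by simp))
  simp only [residualNu, Nat.cast_one, div_one, Nat.cast_zero, zero_mul, one_mul, sub_zero] at e1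
  have e2 := hD 0 h y v harc' hK' 0 ⟨le_rfl, h0.le⟩ h (by simp [h0.le]) h0.ne'
    (by rw [abs_of_pos h0]; exact hl2.trans hh₂1)
  simp only [zero_add] at s1 s2 e2
  rw [s1.velocityMinus_eq, s2.velocityMinus_eq, rieszSnd_neg, sub_neg_eq_add, ← neg_add,
    norm_neg] at e1
  set A := discreteMomentum L α γ ((y 0, h⁻¹ • (y h - y 0)), h)
  set B := velocityDeriv L (y 0, v 0)
  have hx0 : (y 0, v 0) = x := by rw [hy0, hv0]
  rw [hx0, abs_of_pos h0] at e2
  have e3 : ‖rieszSnd A + rieszSnd B - (h * errorCoeff α γ) • rieszSnd (momentumDefect L x)‖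
      ≤ D * h ^ 2 := by
    refine le_trans (le_of_eq ?_) ((norm_rieszSnd_le _).trans e2)
    congr 1
    simp only [rieszSnd, ContinuousLinearMap.sub_comp, ContinuousLinearMap.add_comp,
      ContinuousLinearMap.smul_comp, map_sub, map_add, map_smul]
  have e4 := (norm_sub_le _ _).trans (add_le_add e1 e3)
  rw [sub_sub_cancel, norm_smul, Real.norm_eq_abs, abs_mul, abs_of_pos h0] at e4
  refine le_of_mul_le_mul_left ?_ h0
  linarith

end Orders

/-! ### The control-independent Lagrangian -/

section NewLagrangian

variable {n m : ℕ} {f : Conf n × Conf n → Conf n} {ρ : Conf n → (Conf m →L[ℝ] Conf n)}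
  {g : Conf n → (Conf m →L[ℝ] Conf m)}

theorem contDiff_toDual_symm {k : WithTop ℕ∞} :
    ContDiff ℝ k (InnerProductSpace.toDual ℝ (Conf n)).symm := by
  refine IsBoundedLinearMap.contDiff (IsLinearMap.with_bound ⟨map_add _, fun c x => ?_⟩ 1 fun x => ?_)
  · simp
  · simp

theorem contDiff_adjoint {k : WithTop ℕ∞} :
    ContDiff ℝ k (ContinuousLinearMap.adjoint : (Conf m →L[ℝ] Conf n) → (Conf n →L[ℝ] Conf m)) := by
  refine IsBoundedLinearMap.contDiff (IsLinearMap.with_bound ⟨map_add _, fun c x => ?_⟩ 1 fun x => ?_)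
  · simp
  · simp

/-- A positive definite endomorphism as a linear equivalence. -/
theorem exists_equiv_of_posDef {A : Conf m →L[ℝ] Conf m}
    (hA : ∀ u, u ≠ 0 → 0 < inner ℝ u (A u)) : ∃ e : Conf m ≃L[ℝ] Conf m, (e : Conf m →L[ℝ] Conf m) = A := by
  have hinj : Function.Injective (A : Conf m →ₗ[ℝ] Conf m) := by
    refine (injective_iff_map_eq_zero _).2 fun u hu => ?_
    by_contra h0
    have := hA u h0
    rw [show A u = 0 from hu, inner_zero_right] at this
    exact lt_irrefl _ this
  exact ⟨(LinearEquiv.ofInjectiveEndo (A : Conf m →ₗ[ℝ] Conf m) hinj).toContinuousLinearEquiv,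
    ContinuousLinearMap.ext fun u => rfl⟩

theorem contDiff_controlMatrix {k : WithTop ℕ∞} (hρ : ContDiff ℝ k ρ) (hg : ContDiff ℝ k g)
    (hpos : ∀ q u, u ≠ 0 → 0 < inner ℝ u (g q u)) : ContDiff ℝ k (controlMatrix ρ g) := by
  have hinv : ContDiff ℝ k fun q => ContinuousLinearMap.inverse (g q) := by
    refine contDiff_iff_contDiffAt.2 fun q => ?_
    obtain ⟨e, he⟩ := exists_equiv_of_posDef (hpos q)
    have := contDiffAt_map_inverse (n := k) e
    rw [he] at this
    exact this.comp q hg.contDiffAt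
  exact hρ.clm_comp (hinv.clm_comp (contDiff_adjoint.comp hρ))

theorem contDiff_newLagrangian {k : WithTop ℕ∞} (hf : ContDiff ℝ k f) (hρ : ContDiff ℝ k ρ)
    (hg : ContDiff ℝ k g) (hpos : ∀ q u, u ≠ 0 → 0 < inner ℝ u (g q u)) :
    ContDiff ℝ k (newLagrangian f ρ g) := by
  have hb := contDiff_controlMatrix hρ hg hpos
  have hb' : ContDiff ℝ k fun x : Phase n × Phase n => controlMatrix ρ g x.1.1 x.1.2 :=
    (hb.comp (contDiff_fst.comp contDiff_fst)).clm_apply (contDiff_snd.comp contDiff_fst)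
  unfold newLagrangian
  exact ((ContDiff.inner ℝ (by fun_prop) (by fun_prop)).add
    (ContDiff.inner ℝ (by fun_prop) (hf.comp (by fun_prop)))).add
      (contDiff_const.mul (ContDiff.inner ℝ (by fun_prop) hb'))

/-- The functional `w ↦ λᵀ (∂f/∂v) w`. -/
noncomputable def costateVelocityForm (f : Conf n × Conf n → Conf n) (y : Phase n) (v : Conf n) :
    Conf n →L[ℝ] ℝ :=
  (innerSL ℝ y.2).comp ((fderiv ℝ f (y.1, v)).comp
    (ContinuousLinearMap.inr ℝ (Conf n) (Conf n)))

/-- The inverse Legendre transform of the control-independent Lagrangian. -/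
noncomputable def inverseLegendre (f : Conf n × Conf n → Conf n)
    (z : Phase n × (Phase n →L[ℝ] ℝ)) : Phase n :=
  (rieszSnd z.2, (InnerProductSpace.toDual ℝ (Conf n)).symm
    (z.2.comp (ContinuousLinearMap.inl ℝ (Conf n) (Conf n))
      - costateVelocityForm f z.1 (rieszSnd z.2)))

theorem contDiff_inverseLegendre {k l : WithTop ℕ∞} (hf : ContDiff ℝ k f) (hl : l + 1 ≤ k) :
    ContDiff ℝ l (inverseLegendre f) := by
  have h1 : ContDiff ℝ l fun z : Phase n × (Phase n →L[ℝ] ℝ) => rieszSnd z.2 :=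
    contDiff_toDual_symm.comp (contDiff_snd.clm_comp contDiff_const)
  have h2 : ContDiff ℝ l fun z : Phase n × (Phase n →L[ℝ] ℝ) =>
      fderiv ℝ f (z.1.1, rieszSnd z.2) :=
    (hf.fderiv_right hl).comp ((contDiff_fst.comp contDiff_fst).prodMk h1)
  have h3 : ContDiff ℝ l fun z : Phase n × (Phase n →L[ℝ] ℝ) => innerSL ℝ z.1.2 :=
    (innerSL ℝ : Conf n →L[ℝ] _).contDiff.comp (contDiff_snd.comp contDiff_fst)
  exact h1.prodMk (contDiff_toDual_symm.comp ((contDiff_snd.clm_comp contDiff_const).sub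
    (h3.clm_comp (h2.clm_comp contDiff_const))))

theorem velocityDeriv_newLagrangian (hf : Differentiable ℝ f)
    (hL : Differentiable ℝ (newLagrangian f ρ g)) (x : Phase n × Phase n) (w : Phase n) :
    velocityDeriv (newLagrangian f ρ g) x w
      = inner ℝ w.2 x.2.1 + inner ℝ x.2.2 w.1 + costateVelocityForm f x.1 x.2.1 w.1 := by
  have h1 : HasFDerivAt (fun w : Phase n => inner ℝ w.2 w.1) _ x.2 :=
    HasFDerivAt.inner ℝ (hasFDerivAt_snd (𝕜 := ℝ) (p := x.2)) (hasFDerivAt_fst (𝕜 := ℝ) (p := x.2))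
  have h2 : HasFDerivAt (fun w : Phase n => f (x.1.1, w.1)) _ x.2 :=
    (hf (x.1.1, x.2.1)).hasFDerivAt.comp x.2
      ((hasFDerivAt_prodMk_right x.1.1 x.2.1).comp x.2 (hasFDerivAt_fst (𝕜 := ℝ) (p := x.2)))
  have h3 : HasFDerivAt (fun w : Phase n => inner ℝ x.1.2 (f (x.1.1, w.1))) _ x.2 :=
    (innerSL ℝ x.1.2).hasFDerivAt.comp x.2 h2
  have h4 := ((h1.fun_add h3).add_const
    ((1 / 2) * inner ℝ x.1.2 (controlMatrix ρ g x.1.1 x.1.2)))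
  rw [(hasFDerivAt_velocity hL x).unique h4]
  simp only [add_apply, ContinuousLinearMap.comp_apply, ContinuousLinearMap.prod_apply,
    fderivInnerCLM_apply, costateVelocityForm, ContinuousLinearMap.coe_fst',
    ContinuousLinearMap.coe_snd', ContinuousLinearMap.inr_apply]
  ring

/-- The `λ`-part of the momentum is `v` itself; once `v` is known, `v_λ` is the `q`-part minus
`(∂f/∂v)ᵀ λ`. -/
theorem hasInverseLegendre_newLagrangian (hf : ContDiff ℝ 4 f) (hρ : ContDiff ℝ 4 ρ)
    (hg : ContDiff ℝ 4 g) (hpos : ∀ q u, u ≠ 0 → 0 < inner ℝ u (g q u)) :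
    HasInverseLegendre (newLagrangian f ρ g) (inverseLegendre f) := by
  have hL := contDiff_newLagrangian hf hρ hg hpos
  have hv := velocityDeriv_newLagrangian (ρ := ρ) (g := g) (hf.differentiable (by norm_num))
    (hL.differentiable (by norm_num))
  refine ⟨hL, contDiff_inverseLegendre hf (by norm_num), fun x => ?_, fun y p => ?_⟩
  · have h1 : rieszSnd (velocityDeriv (newLagrangian f ρ g) x) = x.2.1 := by
      refine ext_inner_right ℝ fun w => ?_
      rw [inner_rieszSnd, hv]
      simp [real_inner_comm]
    refine Prod.ext h1 (ext_inner_right ℝ fun w => ?_)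
    rw [inverseLegendre, h1, InnerProductSpace.toDual_symm_apply, sub_apply,
      ContinuousLinearMap.comp_apply, hv]
    simp
  · refine ContinuousLinearMap.ext fun w => ?_
    rw [hv, inverseLegendre, InnerProductSpace.toDual_symm_apply, sub_apply,
      ContinuousLinearMap.comp_apply, real_inner_comm, inner_rieszSnd]
    have hp : p w = p (0, w.2) + p (w.1, 0) := by simp [← map_add]
    rw [hp]
    simp
    ring

/-- With `w = ρᵀ ρ u`, the value is the quadratic form of `g` at `g⁻¹ w`; moreover `w ≠ 0` because
`wᵀ u = |ρ u|² > 0`. -/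
theorem inner_controlMatrix_pos {q : Conf n} (hpos : ∀ u, u ≠ 0 → 0 < inner ℝ u (g q u))
    (hρ : Function.Injective (ρ q)) {u : Conf m} (hu : u ≠ 0) :
    0 < inner ℝ (ρ q u) (controlMatrix ρ g q (ρ q u)) := by
  obtain ⟨e, he⟩ := exists_equiv_of_posDef hpos
  set w := ContinuousLinearMap.adjoint (ρ q) (ρ q u) with hw
  have hρu : ρ q u ≠ 0 := fun h => hu (hρ (h.trans (map_zero (ρ q)).symm))
  have hw0 : w ≠ 0 := by
    intro h
    have h1 : inner ℝ w u = inner ℝ (ρ q u) (ρ q u) := by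
      rw [hw, ContinuousLinearMap.adjoint_inner_left]
    rw [h, inner_zero_left] at h1
    exact hρu (inner_self_eq_zero.1 h1.symm)
  have hb : controlMatrix ρ g q (ρ q u) = ρ q (e.symm w) := by
    simp [controlMatrix, ← he, hw]
  rw [hb, ← ContinuousLinearMap.adjoint_inner_left, ← hw, real_inner_comm]
  have := hpos (e.symm w) (by simpa using hw0)
  rwa [← he, ContinuousLinearEquiv.coe_coe, ContinuousLinearEquiv.apply_symm_apply] at this

/-- At some state at rest the leading error terms do not vanish. -/
theorem exists_positionDeriv_ne_zero (hL : Differentiable ℝ (newLagrangian f ρ g)) (hm : 0 < m)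
    (hρ : Function.Injective (ρ 0)) (hpos : ∀ u, u ≠ 0 → 0 < inner ℝ u (g 0 u)) :
    ∃ l η : Conf n, positionDeriv (newLagrangian f ρ g) ((0, l), (0, η)) (0, η) ≠ 0 := by
  by_contra! H
  -- At `v = 0` the term `v_λᵀ v` drops out, so the `λ`-derivative does not depend on `η`. Letting
  -- `η` vary, the negated claim forces this derivative to vanish.
  have hder : ∀ l η : Conf n, HasFDerivAt (fun l => newLagrangian f ρ g ((0, l), (0, 0)))
      ((positionDeriv (newLagrangian f ρ g) ((0, l), (0, η))).comp
        (ContinuousLinearMap.inr ℝ (Conf n) (Conf n))) l := fun l η => by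
    have h1 : HasFDerivAt (fun l => newLagrangian f ρ g ((0, l), (0, η))) _ l :=
      HasFDerivAt.comp (f := fun l : Conf n => ((0 : Conf n), l)) l
        (hasFDerivAt_position hL ((0, l), (0, η))) (hasFDerivAt_prodMk_right 0 l)
    simpa [newLagrangian] using h1
  have hzero : ∀ l : Conf n, fderiv ℝ (fun l => newLagrangian f ρ g ((0, l), (0, 0))) l = 0 :=
    fun l => ContinuousLinearMap.ext fun η => by
      rw [(hder l η).fderiv]
      exact H l η
  have hconst := is_const_of_fderiv_eq_zero (fun l => (hder l 0).differentiableAt) hzero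
  set u : Conf m := EuclideanSpace.single ⟨0, hm⟩ 1 with hu
  have hu0 : u ≠ 0 := by simp [hu]
  have hp := inner_controlMatrix_pos hpos hρ hu0
  -- Adding the values at `ρ u` and `-ρ u` removes the linear term `λᵀ f(0, 0)` and leaves the
  -- positive quadratic one.
  have h1 := hconst (ρ 0 u) 0
  have h2 := hconst (-ρ 0 u) 0
  simp [newLagrangian] at h1 h2
  linarith

/-- The `λ`-part of the momentum is `v`, independent of position. The second summand of
`momentumDefect` thus vanishes in `λ`-directions, and only `∂L/∂λ` remains there. -/
theorem rieszSnd_momentumDefect_ne_zero (hf : Differentiable ℝ f)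
    (hL : Differentiable ℝ (newLagrangian f ρ g))
    (hLv : Differentiable ℝ (velocityDeriv (newLagrangian f ρ g))) {x : Phase n × Phase n}
    {η : Conf n} (hη : positionDeriv (newLagrangian f ρ g) x (0, η) ≠ 0) :
    rieszSnd (momentumDefect (newLagrangian f ρ g) x) ≠ 0 := by
  intro h
  have h1 := inner_rieszSnd (momentumDefect (newLagrangian f ρ g) x) η
  have e : (fun x => velocityDeriv (newLagrangian f ρ g) x (0, η))
      = fun x : Phase n × Phase n => inner ℝ η x.2.1 := by
    funext x
    simp [velocityDeriv_newLagrangian hf hL]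
  have h2 := (hLv x).hasFDerivAt.clm_apply (hasFDerivAt_const ((0, η) : Phase n) x)
  rw [e] at h2
  have h3 : HasFDerivAt (fun x : Phase n × Phase n => inner ℝ η x.2.1) _ x :=
    ((innerSL ℝ η).comp ((ContinuousLinearMap.fst ℝ (Conf n) (Conf n)).comp
      (ContinuousLinearMap.snd ℝ (Phase n) (Phase n)))).hasFDerivAt
  have h4 := congrArg (fun A => A (x.2, 0)) (h2.unique h3)
  rw [h, inner_zero_left, momentumDefect, add_apply] at h1
  simp at h4
  rw [h4, add_zero] at h1
  exact hη h1.symm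

end NewLagrangian

theorem mainTheorem6 :
    ∃ d : ℕ, ∀ (n m : ℕ) (f : Conf n × Conf n → Conf n) (ρ : Conf n → (Conf m →L[ℝ] Conf n))
      (g : Conf n → (Conf m →L[ℝ] Conf m)) (φ : Conf n × Conf n → ℝ),
      ContDiff ℝ d f → ContDiff ℝ d ρ → ContDiff ℝ d g → ContDiff ℝ d φ →
      (∀ q, Function.Injective (ρ q)) →
      (∀ q, IsSelfAdjoint (g q)) → (∀ q u, u ≠ 0 → 0 < inner ℝ u (g q u)) →
      ExactDiscreteLagrangianWellDefined (newLagrangian f ρ g) ∧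
      ∀ α ∈ Icc (0 : ℝ) 1, ∀ γ ∈ Icc (0 : ℝ) 1,
        ((α = 1 / 2 ∨ γ = 1 / 2) →
          LagrangianHasOrder (newLagrangian f ρ g)
            (lowOrderDiscreteLagrangian (newLagrangian f ρ g) α γ) 2 ∧
          ConditionsHaveOrder (newLagrangian f ρ g) φ
            (lowOrderDiscreteLagrangian (newLagrangian f ρ g) α γ) 2) ∧
        (¬ (α = 1 / 2 ∨ γ = 1 / 2) →
          LagrangianHasOrder (newLagrangian f ρ g)
            (lowOrderDiscreteLagrangian (newLagrangian f ρ g) α γ) 1 ∧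
          ConditionsHaveOrder (newLagrangian f ρ g) φ
            (lowOrderDiscreteLagrangian (newLagrangian f ρ g) α γ) 1 ∧
          (0 < m →
            ¬ LagrangianHasOrder (newLagrangian f ρ g)
              (lowOrderDiscreteLagrangian (newLagrangian f ρ g) α γ) 2 ∧
            ¬ ConditionsHaveOrder (newLagrangian f ρ g) φ
              (lowOrderDiscreteLagrangian (newLagrangian f ρ g) α γ) 2)) := by
  -- Class `C⁴` makes the discrete momentum `C³`, as the odd Taylor estimate needs, and the
  -- acceleration `C²`, as the third order expansion of the position needs.
  refine ⟨4, fun n m f ρ g φ hf hρ hg hφ hinj _ hpos => ?_⟩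
  have hV := hasInverseLegendre_newLagrangian hf hρ hg hpos
  have hφ2 : ContDiff ℝ 2 φ := hφ.of_le (by norm_num)
  refine ⟨hV.exactDiscreteLagrangianWellDefined, fun α _ γ _ => ⟨fun h => ?_, fun h => ?_⟩⟩
  · have hr : 2 = 1 ∨ 2 = 2 ∧ errorCoeff α γ = 0 := Or.inr ⟨rfl, errorCoeff_eq_zero_iff.2 h⟩
    exact ⟨hV.lagrangianHasOrder α γ hr, hV.conditionsHaveOrder hφ2 α γ hr⟩
  · refine ⟨hV.lagrangianHasOrder α γ (Or.inl rfl), hV.conditionsHaveOrder hφ2 α γ (Or.inl rfl),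
      fun hm => ?_⟩
    have hκ : errorCoeff α γ ≠ 0 := mt errorCoeff_eq_zero_iff.1 h
    obtain ⟨l, η, hη⟩ := exists_positionDeriv_ne_zero hV.differentiable hm (hinj 0) (hpos 0)
    exact ⟨hV.not_lagrangianHasOrder_two hκ hη, hV.not_conditionsHaveOrder_two φ hκ
      (rieszSnd_momentumDefect_ne_zero (hf.differentiable (by norm_num)) hV.differentiable
        hV.differentiable_velocityDeriv hη)⟩
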